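/- Let $\mathbb k$ be an algebraically closed field of characteristic $\neq 2$, let $\xi\in\mathbb k$ be a root of unity of order $8$ and put $\mathbf i=\xi^2$. Let $(V,c)$ be a finite-dimensional braided vector space (for instance a Yetter–Drinfeld module over a Hopf algebra with its braiding $c$), and say that $V$ has the matrix $(b_{ij})$ in the basis $(x_i)$ if $c(x_i\otimes x_j)=b_{ij}\,x_j\otimes x_i$ for all $i,j$. Let $\mathfrak B(V)=T(V)/\bigoplus_n\ker\mathfrak S_n$ be the Nichols algebra of $(V,c)$, where $\mathfrak S_n$ is the quantum symmetrizer on $V^{\otimes n}$. For $x,y\in V$ let $\mathrm{Ad}_x(y)=\mu(\mathrm{id}-c)(x\otimes y)\in\mathfrak B(V)$ be the braided adjoint action, $\mu$ being the multiplication. For $w\in\mathfrak B(V)$ let $|w|$ be its nilpotency order, i.e. the least $n$ with $w^n=0$ ($\infty$ if there is none). A matrix $(b_{ij})$ is of Cartan type if there are integers $a_{ij}$ with $b_{ij}b_{ji}=b_{ii}^{a_{ij}}$ for all $i,j$. Let $N(1)=\operatorname{char}\mathbb k$ if $\operatorname{char}\mathbb k>0$, and $N(1)=\infty$ otherwise.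 (1) Let $V$ be two-dimensional with one of the following matrices in a basis $\{x,y\}$; in each item the sign is either one, the same throughout the item. * $b^1_q=\begin{pmatrix}-1&q^{-1}\\q&-1\end{pmatrix}$, $q\in\mathbb k^\times$: $\dim\mathfrak B(V)=4$, $b^1_q$ is of Cartan type, $\mathrm{Ad}_x(y)=\mathrm{Ad}_y(x)=0$, $|x|=|y|=2$. * $b^2=\begin{pmatrix}-1&-1\\1&-1\end{pmatrix}$: $\dim\mathfrak B(V)=8$, $b^2$ is of Cartan type, $z_1=\mathrm{Ad}_x(y)=xy+yx$, $|x|=|y|=|z_1|=2$. * $b^3_{\pm+}=\begin{pmatrix}-1&1\\\pm\mathbf i&-1\end{pmatrix}$: $\dim\mathfrak B(V)=16$, not of Cartan type, $z_1=\mathrm{Ad}_x(y)=xy-yx$, $|x|=|y|=2$, $|z_1|=4$. * $b^3_{\pm-}=\begin{pmatrix}-1&-1\\\pm\mathbf i&-1\end{pmatrix}$: $\dim\mathfrak B(V)=16$, not of Cartan type, $z_1=\mathrm{Ad}_x(y)=xy+yx$, $|x|=|y|=2$, $|z_1|=4$. * $b^4_\pm=\begin{pmatrix}\pm\mathbf i&\pm\mathbf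 i\\-1&-1\end{pmatrix}$: $\dim\mathfrak B(V)=16$, not of Cartan type, $z_1=\mathrm{Ad}_y(x)=xy+yx$, $|x|=4$, $|y|=2$, $|z_1|=2$. * $b^5_\pm=\begin{pmatrix}\pm\mathbf i&\mp\mathbf i\\-1&-1\end{pmatrix}$: $\dim\mathfrak B(V)\ge 8N(1)\ge 24$ (so $\mathfrak B(V)$ is infinite-dimensional if $\operatorname{char}\mathbb k=0$), not of Cartan type, $z_1=\mathrm{Ad}_y(x)=xy+yx$, $|x|=4$, $|y|=2$, $|z_1|=N(1)$. * $b^6_m=\begin{pmatrix}-1&1\\\xi^m&-1\end{pmatrix}$, $m\in\{1,3,5,7\}$: $\dim\mathfrak B(V)=32$, not of Cartan type, $z_1=\mathrm{Ad}_x(y)=xy-yx$, $|x|=|y|=2$, $|z_1|=8$; also $|\mathrm{Ad}_y(x)|=8$. (2) Let $V$ be three-dimensional with matrix $$b=b^1_{q_1,q_2,q_3}=\begin{pmatrix}-1&q_1^{-1}&q_3^{-1}\\q_1&-1&q_2^{-1}\\q_3&q_2&-1\end{pmatrix}\qquad(q_1,q_2,q_3\in\mathbb k^\times)$$ in a basis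 $\{x,y,z\}$. Then $\mathfrak B(V)$ is an $8$-dimensional quantum linear space: $b_{ij}b_{ji}=1$ for $i\ne j$, the monomials $x^{n_1}y^{n_2}z^{n_3}$ with $0\le n_1,n_2,n_3<2$ form a basis of $\mathfrak B(V)$, and $\mathfrak B(V)$ is the algebra presented by the generators $x,y,z$ and the relations $$x^2=y^2=z^2=0,\qquad yx=q_1xy,\quad zx=q_3xz,\quad zy=q_2yz.$$ -/

import Mathlib

open scoped TensorProduct

noncomputable section

namespace DiagNichols

universe u v

section Braided

variable {k : Type u} [Field k] {V : Type v} [AddCommGroup V] [Module k V]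

/-- The map `T(V) ⊗ V → T(V)`, `w ⊗ v ↦ w v`. -/
def mulRight (k : Type u) [Field k] (V : Type v) [AddCommGroup V] [Module k V] :
    TensorAlgebra k V ⊗[k] V →ₗ[k] TensorAlgebra k V :=
  LinearMap.mul' k (TensorAlgebra k V) ∘ₗ (TensorAlgebra.ι k (M := V)).lTensor (TensorAlgebra k V)

/-- The map `T(V) ⊗ V ⊗ V → T(V) ⊗ V` which applies the braiding `c` to the last two factors and
then multiplies the first two: if `c (u ⊗ v) = ∑ v' ⊗ u'`, then `w ⊗ u ⊗ v ↦ ∑ w v' ⊗ u'`. -/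
def braidMul (c : V ⊗[k] V →ₗ[k] V ⊗[k] V) :
    (TensorAlgebra k V ⊗[k] V) ⊗[k] V →ₗ[k] TensorAlgebra k V ⊗[k] V :=
  (mulRight k V).rTensor V ∘ₗ
    (TensorProduct.assoc k (TensorAlgebra k V) V V).symm.toLinearMap ∘ₗ
      c.lTensor (TensorAlgebra k V) ∘ₗ
        (TensorProduct.assoc k (TensorAlgebra k V) V V).toLinearMap

/-- For `v : V`, the operator `(w, t) ↦ (w v, w ⊗ v + braidMul c (t ⊗ v))` on
`T(V) × (T(V) ⊗ V)`; auxiliary for the recursive definition of `coprodRight`. -/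
def coprodStep (c : V ⊗[k] V →ₗ[k] V ⊗[k] V) :
    V →ₗ[k] Module.End k (TensorAlgebra k V × (TensorAlgebra k V ⊗[k] V)) :=
  LinearMap.mk₂ k
    (fun v p => (p.1 * TensorAlgebra.ι k v, p.1 ⊗ₜ[k] v + braidMul c (p.2 ⊗ₜ[k] v)))
    (fun v v' p => by
      ext
      · simp [mul_add]
      · simp only [TensorProduct.tmul_add, map_add, Prod.snd_add]; abel)
    (fun a v p => by ext <;> simp [TensorProduct.tmul_smul, smul_add])
    (fun v p p' => by
      ext
      · simp [add_mul]
      · simp only [TensorProduct.add_tmul, Prod.fst_add, Prod.snd_add, map_add]; abel)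
    (fun a v p => by ext <;> simp [← TensorProduct.smul_tmul', smul_add])

theorem coprodStep_apply (c : V ⊗[k] V →ₗ[k] V ⊗[k] V) (v : V)
    (p : TensorAlgebra k V × (TensorAlgebra k V ⊗[k] V)) :
    coprodStep c v p =
      (p.1 * TensorAlgebra.ι k v, p.1 ⊗ₜ[k] v + braidMul c (p.2 ⊗ₜ[k] v)) := rfl

/-- The map `Δ_{n,1} : V^{⊗(n+1)} → V^{⊗n} ⊗ V`, for all `n` at once: the component of the braided
comultiplication of `T(V)` whose right factor has degree one. On `V^{⊗(n+1)}` it is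
`id + c_n + c_n c_{n-1} + ⋯ + c_n c_{n-1} ⋯ c_1`, where `c_i` is `c` acting on the tensor factors
`i, i+1`. It is determined by `coprodRight_one` and `coprodRight_mul_ι`. -/
def coprodRight (c : V ⊗[k] V →ₗ[k] V ⊗[k] V) :
    TensorAlgebra k V →ₗ[k] TensorAlgebra k V ⊗[k] V where
  toFun w := ((TensorAlgebra.lift k
    ((MulOpposite.opLinearEquiv k).toLinearMap ∘ₗ coprodStep c) w).unop (1, 0)).2
  map_add' := by simp
  map_smul' := by simp

theorem coprodRight_one (c : V ⊗[k] V →ₗ[k] V ⊗[k] V) : coprodRight c 1 = 0 := by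
  simp [coprodRight]

theorem coprodRight_mul_ι (c : V ⊗[k] V →ₗ[k] V ⊗[k] V) (w : TensorAlgebra k V) (v : V) :
    coprodRight c (w * TensorAlgebra.ι k v) =
      w ⊗ₜ[k] v + braidMul c (coprodRight c w ⊗ₜ[k] v) := by
  have key : ∀ w : TensorAlgebra k V, ∀ p : TensorAlgebra k V × (TensorAlgebra k V ⊗[k] V),
      ((TensorAlgebra.lift k
        ((MulOpposite.opLinearEquiv k).toLinearMap ∘ₗ coprodStep c) w).unop p).1 = p.1 * w := by
    intro w
    induction w using TensorAlgebra.induction with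
    | algebraMap r => intro p; simp [MulOpposite.algebraMap_apply, Algebra.smul_def, Algebra.commutes]
    | ι x => intro p; simp [coprodStep]
    | mul a b ha hb => intro p; simp [ha, hb, mul_assoc]
    | add a b ha hb => intro p; simp [ha, hb, mul_add]
  have h1 := key w (1, 0)
  rw [one_mul] at h1
  simp only [coprodRight, LinearMap.coe_mk, AddHom.coe_mk, map_mul, MulOpposite.unop_mul,
    Module.End.mul_apply, TensorAlgebra.lift_ι_apply, LinearMap.comp_apply,
    LinearEquiv.coe_coe, MulOpposite.coe_opLinearEquiv, MulOpposite.unop_op]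
  rw [coprodStep_apply, h1]

/-- The quantum symmetrizer `𝔖_n = ∑_{σ ∈ S_n} c_σ : V^{⊗n} → V^{⊗n}`, extended by zero to the other
homogeneous components of `T(V)`; here `c_σ = c_{i_1} ⋯ c_{i_l}` for a reduced expression
`σ = s_{i_1} ⋯ s_{i_l}`. It is given by the usual factorisation
`𝔖_{n+1} = (𝔖_n ⊗ id) (id + c_n + c_n c_{n-1} + ⋯ + c_n ⋯ c_1)`. -/
def quantumSymmetrizer (c : V ⊗[k] V →ₗ[k] V ⊗[k] V) :
    ℕ → (TensorAlgebra k V →ₗ[k] TensorAlgebra k V)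
  | 0 => Algebra.linearMap k (TensorAlgebra k V) ∘ₗ
      (TensorAlgebra.algebraMapInv (R := k) (M := V)).toLinearMap
  | n + 1 => mulRight k V ∘ₗ (quantumSymmetrizer c n).rTensor V ∘ₗ coprodRight c

/-- The Nichols algebra `𝔅(V)` of the braided vector space `(V, c)`: the quotient of the tensor
algebra `T(V)` by the ideal `⨁ n, ker 𝔖_n`. -/
def NicholsAlgebra (c : V ⊗[k] V →ₗ[k] V ⊗[k] V) : Type (max u v) :=
  RingQuot fun a b : TensorAlgebra k V => (∀ n, quantumSymmetrizer c n a = 0) ∧ b = 0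

namespace NicholsAlgebra

instance (c : V ⊗[k] V →ₗ[k] V ⊗[k] V) : Ring (NicholsAlgebra c) :=
  inferInstanceAs (Ring (RingQuot _))

instance (c : V ⊗[k] V →ₗ[k] V ⊗[k] V) : Algebra k (NicholsAlgebra c) :=
  inferInstanceAs (Algebra k (RingQuot _))

/-- The projection `T(V) → 𝔅(V)`. -/
def mk (c : V ⊗[k] V →ₗ[k] V ⊗[k] V) : TensorAlgebra k V →ₐ[k] NicholsAlgebra c :=
  RingQuot.mkAlgHom k _

/-- The canonical map `V → 𝔅(V)`. -/
def ι (c : V ⊗[k] V →ₗ[k] V ⊗[k] V) : V →ₗ[k] NicholsAlgebra c :=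
  (mk c).toLinearMap ∘ₗ TensorAlgebra.ι k

/-- The braided adjoint action `Ad_x(y) = μ (id - c) (x ⊗ y)` in `𝔅(V)`, for the primitive
elements `x ∈ V`, and `y ∈ V`. -/
def Ad (c : V ⊗[k] V →ₗ[k] V ⊗[k] V) (x y : V) : NicholsAlgebra c :=
  (LinearMap.mul' k (NicholsAlgebra c) ∘ₗ TensorProduct.map (ι c) (ι c))
    (x ⊗ₜ[k] y - c (x ⊗ₜ[k] y))

end NicholsAlgebra

/-- `c` has the matrix `b` in the basis `x`: `c (x_i ⊗ x_j) = b_ij x_j ⊗ x_i`. -/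
def HasMatrix {ι : Type*} (c : V ⊗[k] V →ₗ[k] V ⊗[k] V) (x : Module.Basis ι k V)
    (b : Matrix ι ι k) : Prop :=
  ∀ i j, c (x i ⊗ₜ[k] x j) = b i j • (x j ⊗ₜ[k] x i)

end Braided

/-- The braiding matrix `b` is of Cartan type: there is an integer matrix `a` with
`b_ij b_ji = b_ii ^ a_ij` for all `i, j`. -/
def IsCartanType {k : Type*} [Field k] {ι : Type*} (b : Matrix ι ι k) : Prop :=
  ∃ a : Matrix ι ι ℤ, ∀ i j, b i j * b j i = b i i ^ a i j

/-- The condition on a braiding matrix `b` defining quantum linear spaces: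
`b_ij b_ji = 1` for all `i ≠ j`. -/
def IsQuantumLinear {k : Type*} [Field k] {ι : Type*} (b : Matrix ι ι k) : Prop :=
  ∀ i j, i ≠ j → b i j * b j i = 1

open Classical in
/-- The nilpotency order `|w|`: the least `n` with `w ^ n = 0`, and `∞` if there is none. -/
def nilpotencyOrder {A : Type*} [Ring A] (w : A) : ℕ∞ :=
  if IsNilpotent w then (nilpotencyClass w : ℕ∞) else ⊤

open Classical in
/-- `N(q)` is the order of `q` if `q ≠ 1` is a root of unity, the characteristic if `q = 1` and the
characteristic is positive, and `∞` otherwise. -/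
def rootOrder {k : Type*} [Field k] (q : kˣ) : ℕ∞ :=
  if q = 1 then (if ringChar k = 0 then ⊤ else (ringChar k : ℕ∞))
  else (if IsOfFinOrder q then (orderOf q : ℕ∞) else ⊤)

section Matrices

variable {k : Type*} [Field k]

/-- `b^1_q` -/
def b1 (q : kˣ) : Matrix (Fin 2) (Fin 2) k := !![-1, ((q⁻¹ : kˣ) : k); (q : k), -1]

/-- `b^2` -/
def b2 : Matrix (Fin 2) (Fin 2) k := !![-1, -1; 1, -1]

/-- `b^3_{±+}`, where `j = ± i` -/
def b3plus (j : k) : Matrix (Fin 2) (Fin 2) k := !![-1, 1; j, -1]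

/-- `b^3_{±-}`, where `j = ± i` -/
def b3minus (j : k) : Matrix (Fin 2) (Fin 2) k := !![-1, -1; j, -1]

/-- `b^4_±`, where `j = ± i` -/
def b4 (j : k) : Matrix (Fin 2) (Fin 2) k := !![j, j; -1, -1]

/-- `b^5_±`, where `j = ± i` -/
def b5 (j : k) : Matrix (Fin 2) (Fin 2) k := !![j, -j; -1, -1]

/-- `b^6_m` for the fixed root of unity `ξ` of order `8` -/
def b6 (ξ : k) (m : ℕ) : Matrix (Fin 2) (Fin 2) k := !![-1, 1; ξ ^ m, -1]

/-- `b^1_{q₁,q₂,q₃}` -/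
def b1three (q₁ q₂ q₃ : kˣ) : Matrix (Fin 3) (Fin 3) k :=
  !![-1, ((q₁⁻¹ : kˣ) : k), ((q₃⁻¹ : kˣ) : k);
     (q₁ : k), -1, ((q₂⁻¹ : kˣ) : k);
     (q₃ : k), (q₂ : k), -1]

end Matrices

end DiagNichols

end

open scoped TensorProduct

namespace DiagNichols

/-! For a braiding of diagonal type, 𝔅(V) carries skew derivations ∂_i, which braid a letter x_i to
the right end of a word and strip it off. Since 𝔖_{n+1} a = 0 exactly when 𝔖_n kills every ∂_i a, an
element without constant term killed by all ∂_i is zero. `SkewDerivationSystem` axiomatises this and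
`nicholsSystem` constructs it. Relations are then proved by differentiating them to zero, and linear
independence by differentiating a linear relation.

In rank two let x = `gen s`, y = `gen t` with b_tt = -1, so y² = 0, and z = yx - b_ts xy. Then ∂_t z
= 0, ∂_s z = (1 - b_st b_ts) y, and z has self-braiding p = -b_ss b_st b_ts. Hence ∂_s z^(n+1) = (1
- b_st b_ts)(1 + p + ... + p^n) z^n y (`D_comm_pow`), which determines the nilpotency order of z.
The monomials x^m z^n y^l below the orders M of x and N of z are independent
(`linearIndependent_pbw`). They span (`span_pbw`) if (1 + b_ss)(1 - b_ss b_st b_ts) = 0, since then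
z commutes with x up to a scalar; the dimension is 2NM. This covers every rank-two item except b^5,
where the condition fails and p = 1, so that independence gives only a lower bound.

In rank three the braided commutators of distinct generators have zero derivatives. The eight
ordered monomials already span the algebra defined by the relations, and they are independent in
𝔅(V), which gives both the basis and the presentation. -/

/-- Skew derivations `D i` with twists `twist i` on an algebra generated by the `gen i`, for which an
element without constant term killed by all `D i` vanishes. -/
structure SkewDerivationSystem {k : Type*} [Field k] {I : Type*} [DecidableEq I] (b : Matrix I I k)
    {B : Type*} [Ring B] [Algebra k B] (gen : I → B) where
  /-- the counit -/
  counit : B →ₐ[k] k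
  /-- the algebra endomorphism rescaling `gen j` by `b i j` -/
  twist : I → B →ₐ[k] B
  /-- the skew derivations -/
  D : I → B →ₗ[k] B
  counit_gen : ∀ i, counit (gen i) = 0
  twist_gen : ∀ i j, twist i (gen j) = b i j • gen j
  D_gen : ∀ i j, D i (gen j) = if i = j then 1 else 0
  D_mul : ∀ i a a', D i (a * a') = a * D i a' + D i a * twist i a'
  eq_zero : ∀ a, counit a = 0 → (∀ i, D i a = 0) → a = 0
  adjoin_gen : Algebra.adjoin k (Set.range gen) = ⊤

/-- Induction on vectors along a basis. -/
theorem basis_induction {k : Type*} [Field k] {V : Type*} [AddCommGroup V] [Module k V] {I : Type*}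
    (x : Module.Basis I k V) {p : V → Prop} (zero : p 0) (add : ∀ v w, p v → p w → p (v + w))
    (smul : ∀ (r : k) v, p v → p (r • v)) (basis : ∀ i, p (x i)) (v : V) : p v := by
  have hv : v ∈ Submodule.span k (Set.range x) := x.mem_span v
  induction hv using Submodule.span_induction with
  | mem v hv => obtain ⟨i, rfl⟩ := hv; exact basis i
  | zero => exact zero
  | add v w _ _ hv hw => exact add v w hv hw
  | smul r v _ hv => exact smul r v hv

/-! ### Skew derivations of the tensor algebra and kernels of the quantum symmetrizers. -/

section Tensor

variable {k : Type*} [Field k] {V : Type*} [AddCommGroup V] [Module k V]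

/-- For the zero braiding only the identity term of Δ_{n,1} survives, so it strips off the last
letter. This is a left inverse of `mulRight`. -/
theorem coprodRight_zero_mulRight (t : TensorAlgebra k V ⊗[k] V) :
    coprodRight (0 : V ⊗[k] V →ₗ[k] V ⊗[k] V) (mulRight k V t) = t := by
  induction t with
  | zero => simp
  | add s t hs ht => rw [map_add, map_add, hs, ht]
  | tmul w v =>
    have h : mulRight k V (w ⊗ₜ[k] v) = w * TensorAlgebra.ι k v := by simp [mulRight]
    rw [h, coprodRight_mul_ι]
    simp [braidMul]

theorem mulRight_injective : Function.Injective (mulRight k V) :=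
  Function.LeftInverse.injective coprodRight_zero_mulRight

variable {I : Type*} [Fintype I] [DecidableEq I]
  (c : V ⊗[k] V →ₗ[k] V ⊗[k] V) (x : Module.Basis I k V) (b : Matrix I I k)

/-- Contraction of the right tensor factor with the `i`-th coordinate. -/
noncomputable def contract (i : I) : TensorAlgebra k V ⊗[k] V →ₗ[k] TensorAlgebra k V :=
  (TensorProduct.rid k (TensorAlgebra k V)).toLinearMap ∘ₗ (x.coord i).lTensor (TensorAlgebra k V)

omit [Fintype I] [DecidableEq I] in
theorem contract_tmul (i : I) (w : TensorAlgebra k V) (v : V) :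
    contract x i (w ⊗ₜ[k] v) = x.coord i v • w := by
  simp [contract]

omit [DecidableEq I] in
theorem sum_contract_tmul (t : TensorAlgebra k V ⊗[k] V) :
    ∑ i, contract x i t ⊗ₜ[k] x i = t := by
  induction t with
  | zero => simp
  | add s t hs ht => simp only [map_add, TensorProduct.add_tmul, Finset.sum_add_distrib, hs, ht]
  | tmul w v =>
    simp only [contract_tmul, TensorProduct.smul_tmul, ← TensorProduct.tmul_sum]
    congr 1
    exact x.sum_repr v

/-- The skew derivation `∂_i` of the tensor algebra. -/
noncomputable def tensorD (i : I) : TensorAlgebra k V →ₗ[k] TensorAlgebra k V :=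
  contract x i ∘ₗ coprodRight c

/-- The algebra endomorphism `x_j ↦ b_ij x_j` of the tensor algebra. -/
noncomputable def tensorTwist (i : I) : TensorAlgebra k V →ₐ[k] TensorAlgebra k V :=
  TensorAlgebra.lift k (TensorAlgebra.ι k ∘ₗ x.constr k fun j => b i j • x j)

theorem tensorTwist_ι (i j : I) :
    tensorTwist x b i (TensorAlgebra.ι k (x j)) = b i j • TensorAlgebra.ι k (x j) := by
  simp [tensorTwist]

variable {c x b}

/-- Moving x_i to the right past x_j costs the factor b_ij and leaves x_j behind. This is where the
diagonal form of the braiding enters the Leibniz rule. -/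
theorem contract_braidMul (hc : HasMatrix c x b) (i : I) (t : TensorAlgebra k V ⊗[k] V) (v : V) :
    contract x i (braidMul c (t ⊗ₜ[k] v)) =
      contract x i t * tensorTwist x b i (TensorAlgebra.ι k v) := by
  induction v using basis_induction x with
  | zero => simp
  | add v w hv hw => simp only [TensorProduct.tmul_add, map_add, hv, hw, mul_add]
  | smul a v hv => simp only [TensorProduct.tmul_smul, map_smul, hv, mul_smul_comm]
  | basis j =>
    rw [tensorTwist_ι]
    induction t with
    | zero => simp
    | add s t hs ht => simp only [TensorProduct.add_tmul, map_add, hs, ht, add_mul]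
    | tmul w v =>
      induction v using basis_induction x with
      | zero => simp
      | add v w hv hw => simp only [TensorProduct.tmul_add, TensorProduct.add_tmul, map_add, hv, hw, add_mul]
      | smul a v hv =>
        simp only [TensorProduct.tmul_smul, ← TensorProduct.smul_tmul', map_smul, hv, smul_mul_assoc]
      | basis l =>
        simp only [braidMul, LinearMap.comp_apply, LinearEquiv.coe_coe, TensorProduct.assoc_tmul,
          LinearMap.lTensor_tmul, hc l j, TensorProduct.tmul_smul, map_smul,
          TensorProduct.assoc_symm_tmul, LinearMap.rTensor_tmul, contract_tmul, mulRight,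
          LinearMap.mul'_apply, Module.Basis.coord_apply, Module.Basis.repr_self]
        by_cases h : l = i
        · subst h; simp
        · simp [h]

omit [Fintype I] [DecidableEq I] in
theorem tensorD_one (i : I) : tensorD c x i 1 = 0 := by
  simp [tensorD, coprodRight_one]

theorem tensorD_mul_ι (hc : HasMatrix c x b) (i : I) (w : TensorAlgebra k V) (v : V) :
    tensorD c x i (w * TensorAlgebra.ι k v) =
      x.coord i v • w + tensorD c x i w * tensorTwist x b i (TensorAlgebra.ι k v) := by
  simp only [tensorD, LinearMap.comp_apply, coprodRight_mul_ι, map_add, contract_tmul,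
    contract_braidMul hc]

theorem tensorD_ι (hc : HasMatrix c x b) (i : I) (v : V) :
    tensorD c x i (TensorAlgebra.ι k v) = algebraMap k _ (x.coord i v) := by
  have := tensorD_mul_ι hc i 1 v
  rwa [one_mul, tensorD_one, zero_mul, add_zero, ← Algebra.algebraMap_eq_smul_one] at this

theorem tensorD_mul (hc : HasMatrix c x b) (i : I) (a a' : TensorAlgebra k V) :
    tensorD c x i (a * a') = a * tensorD c x i a' + tensorD c x i a * tensorTwist x b i a' := by
  induction a' using TensorAlgebra.induction generalizing a with
  | algebraMap r =>
    rw [← Algebra.commutes, ← Algebra.smul_def, Algebra.algebraMap_eq_smul_one]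
    simp [tensorD_one]
  | ι v =>
    rw [tensorD_mul_ι hc, tensorD_ι hc, ← Algebra.commutes, Algebra.smul_def]
  | mul p q hp hq =>
    rw [← mul_assoc, hq (a * p), hp a, hq p, map_mul]
    noncomm_ring
  | add p q hp hq => simp only [mul_add, map_add, hp, hq]; abel

/-- ∂_j removes one letter x_j, which the twist had scaled by b_ij. It follows that twists preserve
ker 𝔖_n. -/
theorem tensorD_tensorTwist (hc : HasMatrix c x b) (i j : I) (a : TensorAlgebra k V) :
    tensorD c x j (tensorTwist x b i a) = b i j • tensorTwist x b i (tensorD c x j a) := by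
  have comm (i j : I) (a : TensorAlgebra k V) :
      tensorTwist x b i (tensorTwist x b j a) = tensorTwist x b j (tensorTwist x b i a) := by
    suffices h : (tensorTwist x b i).comp (tensorTwist x b j) =
        (tensorTwist x b j).comp (tensorTwist x b i) from DFunLike.congr_fun h a
    apply TensorAlgebra.hom_ext
    apply x.ext
    intro l
    simp [tensorTwist_ι, smul_smul, mul_comm]
  induction a using TensorAlgebra.induction with
  | algebraMap r => simp [Algebra.algebraMap_eq_smul_one, tensorD_one]
  | ι v =>
    induction v using basis_induction x with
    | zero => simp
    | add v w hv hw => simp only [map_add, hv, hw, smul_add]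
    | smul r v hv => simp only [map_smul, hv, smul_comm r]
    | basis l =>
      rw [tensorTwist_ι, map_smul, tensorD_ι hc]
      by_cases h : l = j
      · subst h; simp
      · simp [h]
  | mul p q hp hq =>
    rw [map_mul, tensorD_mul hc, hp, hq, tensorD_mul hc, map_add, map_mul, map_mul, comm j i]
    simp [smul_add]
  | add p q hp hq => simp only [map_add, hp, hq, smul_add]

theorem quantumSymmetrizer_zero_eq_zero_iff (a : TensorAlgebra k V) :
    quantumSymmetrizer c 0 a = 0 ↔ TensorAlgebra.algebraMapInv (R := k) (M := V) a = 0 := by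
  simp [quantumSymmetrizer]

-- Since `mulRight` is injective and the x_i form a basis, the recursion for 𝔖_{n+1} can be tested
-- one coordinate at a time. From here on derivations replace symmetrizers.
variable (x) in
theorem quantumSymmetrizer_succ_eq_zero_iff (n : ℕ) (a : TensorAlgebra k V) :
    quantumSymmetrizer c (n + 1) a = 0 ↔ ∀ i, quantumSymmetrizer c n (tensorD c x i a) = 0 := by
  have h : quantumSymmetrizer c (n + 1) a =
      mulRight k V (∑ i, quantumSymmetrizer c n (tensorD c x i a) ⊗ₜ[k] x i) := by
    have h1 : quantumSymmetrizer c (n + 1) a =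
      mulRight k V ((quantumSymmetrizer c n).rTensor V (coprodRight c a)) := rfl
    rw [h1]
    conv_lhs => rw [← sum_contract_tmul x (coprodRight c a)]
    simp [tensorD]
  rw [h, map_eq_zero_iff _ mulRight_injective]
  refine ⟨fun h i => ?_, fun h => by simp [h]⟩
  have := congrArg (contract x i) h
  simpa [contract_tmul, Finsupp.single_apply] using this

theorem quantumSymmetrizer_tensorTwist (hc : HasMatrix c x b) (i : I) (n : ℕ)
    (a : TensorAlgebra k V) (ha : quantumSymmetrizer c n a = 0) :
    quantumSymmetrizer c n (tensorTwist x b i a) = 0 := by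
  induction n generalizing a with
  | zero =>
    rw [quantumSymmetrizer_zero_eq_zero_iff] at ha ⊢
    rw [← ha]
    suffices h : (TensorAlgebra.algebraMapInv (R := k) (M := V)).comp (tensorTwist x b i) =
        TensorAlgebra.algebraMapInv from DFunLike.congr_fun h a
    apply TensorAlgebra.hom_ext
    apply x.ext
    intro l
    simp [tensorTwist_ι, TensorAlgebra.algebraMapInv]
  | succ n ih =>
    rw [quantumSymmetrizer_succ_eq_zero_iff x] at ha ⊢
    intro j
    rw [tensorD_tensorTwist hc, map_smul, ih _ (ha j), smul_zero]

/-- The Leibniz rule reduces degree n + 1 to degree n. The hypothesis quantifies over all degrees so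
that it passes to the derivatives and twists of the factors. -/
theorem quantumSymmetrizer_mul (hc : HasMatrix c x b) (n : ℕ) (a a' : TensorAlgebra k V)
    (h : (∀ m, quantumSymmetrizer c m a = 0) ∨ ∀ m, quantumSymmetrizer c m a' = 0) :
    quantumSymmetrizer c n (a * a') = 0 := by
  induction n generalizing a a' with
  | zero =>
    rw [quantumSymmetrizer_zero_eq_zero_iff, map_mul]
    rcases h with h | h
    · rw [(quantumSymmetrizer_zero_eq_zero_iff a).1 (h 0), zero_mul]
    · rw [(quantumSymmetrizer_zero_eq_zero_iff a').1 (h 0), mul_zero]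
  | succ n ih =>
    rw [quantumSymmetrizer_succ_eq_zero_iff x]
    intro i
    rw [tensorD_mul hc, map_add]
    rcases h with h | h
    · rw [ih a _ (Or.inl h), ih _ _ (Or.inl fun m =>
        (quantumSymmetrizer_succ_eq_zero_iff x m a).1 (h (m + 1)) i), add_zero]
    · rw [ih a _ (Or.inr fun m => (quantumSymmetrizer_succ_eq_zero_iff x m a').1 (h (m + 1)) i),
        ih _ _ (Or.inr fun m => quantumSymmetrizer_tensorTwist hc i m a' (h m)), add_zero]

end Tensor

/-! ### The Nichols algebra as a skew derivation system. -/

section Quotient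

variable {k : Type*} [Field k] {V : Type*} [AddCommGroup V] [Module k V]
  {I : Type*} [Fintype I] [DecidableEq I]
  {c : V ⊗[k] V →ₗ[k] V ⊗[k] V} {x : Module.Basis I k V} {b : Matrix I I k}

theorem NicholsAlgebra.mk_surjective (c : V ⊗[k] V →ₗ[k] V ⊗[k] V) :
    Function.Surjective (NicholsAlgebra.mk c) :=
  RingQuot.mkAlgHom_surjective k _

/-- The ideal `⨁ n, ker 𝔖_n` of the tensor algebra. -/
noncomputable def symmetrizerIdeal (hc : HasMatrix c x b) : TwoSidedIdeal (TensorAlgebra k V) :=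
  TwoSidedIdeal.mk' {a | ∀ n, quantumSymmetrizer c n a = 0}
    (by simp)
    (fun ha hb n => by rw [map_add, ha n, hb n, add_zero])
    (fun ha n => by rw [map_neg, ha n, neg_zero])
    (fun hb n => quantumSymmetrizer_mul hc n _ _ (Or.inr hb))
    (fun ha n => quantumSymmetrizer_mul hc n _ _ (Or.inl ha))

/-- The elements killed by every 𝔖_n already form a two-sided ideal, so the quotient they generate
kills nothing more. -/
theorem NicholsAlgebra.mk_eq_zero_iff (hc : HasMatrix c x b) (a : TensorAlgebra k V) :
    NicholsAlgebra.mk c a = 0 ↔ ∀ n, quantumSymmetrizer c n a = 0 := by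
  constructor
  · intro h
    let f : TensorAlgebra k V →+* (symmetrizerIdeal hc).ringCon.Quotient :=
      (symmetrizerIdeal hc).ringCon.mk'
    have hf (a : TensorAlgebra k V) : f a = 0 ↔ ∀ n, quantumSymmetrizer c n a = 0 := by
      have : f a = 0 ↔ a ∈ symmetrizerIdeal hc := by
        conv_rhs => rw [← TwoSidedIdeal.ker_ringCon_mk' (symmetrizerIdeal hc)]
        rw [TwoSidedIdeal.mem_ker]
      rw [this, symmetrizerIdeal, TwoSidedIdeal.mem_mk']
      rfl
    let g : RingQuot (fun a b : TensorAlgebra k V =>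
        (∀ n, quantumSymmetrizer c n a = 0) ∧ b = 0) →+* (symmetrizerIdeal hc).ringCon.Quotient :=
      RingQuot.lift ⟨f, fun a a' ha => by rw [ha.2, map_zero, (hf a).2 ha.1]⟩
    have hg : g (RingQuot.mkRingHom _ a) = f a := RingQuot.lift_mkRingHom_apply _ _ _
    rw [← hf, ← hg, ← RingQuot.mkAlgHom_coe k]
    exact (congrArg g h).trans (map_zero g)
  · intro h
    exact (RingQuot.mkAlgHom_rel k ⟨h, rfl⟩).trans (map_zero _)

/-- Descent of a linear endomorphism of `T(V)` to the Nichols algebra. -/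
noncomputable def NicholsAlgebra.descend (f : TensorAlgebra k V →ₗ[k] TensorAlgebra k V)
    (hf : ∀ a, NicholsAlgebra.mk c a = 0 → NicholsAlgebra.mk c (f a) = 0) :
    NicholsAlgebra c →ₗ[k] NicholsAlgebra c :=
  (LinearMap.ker (NicholsAlgebra.mk c).toLinearMap).liftQ ((NicholsAlgebra.mk c).toLinearMap ∘ₗ f)
      (fun a ha => hf a ha) ∘ₗ
    ((NicholsAlgebra.mk c).toLinearMap.quotKerEquivOfSurjective
      (NicholsAlgebra.mk_surjective c)).symm.toLinearMap

theorem NicholsAlgebra.descend_mk (f : TensorAlgebra k V →ₗ[k] TensorAlgebra k V)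
    (hf : ∀ a, NicholsAlgebra.mk c a = 0 → NicholsAlgebra.mk c (f a) = 0) (a : TensorAlgebra k V) :
    NicholsAlgebra.descend f hf (NicholsAlgebra.mk c a) = NicholsAlgebra.mk c (f a) := by
  have h : ((NicholsAlgebra.mk c).toLinearMap.quotKerEquivOfSurjective
      (NicholsAlgebra.mk_surjective c)).symm (NicholsAlgebra.mk c a) = Submodule.Quotient.mk a := by
    rw [LinearEquiv.symm_apply_eq]
    rfl
  simp only [NicholsAlgebra.descend, LinearMap.comp_apply, LinearEquiv.coe_coe, h]
  rfl

/-- The skew derivations of the Nichols algebra of a braided vector space of diagonal type. -/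
noncomputable def nicholsSystem (hc : HasMatrix c x b) :
    SkewDerivationSystem b fun i => NicholsAlgebra.ι c (x i) := by
  have hT (i : I) (a : TensorAlgebra k V) (ha : NicholsAlgebra.mk c a = 0) :
      NicholsAlgebra.mk c (tensorTwist x b i a) = 0 := by
    rw [NicholsAlgebra.mk_eq_zero_iff hc] at ha ⊢
    exact fun n => quantumSymmetrizer_tensorTwist hc i n a (ha n)
  have hD (i : I) (a : TensorAlgebra k V) (ha : NicholsAlgebra.mk c a = 0) :
      NicholsAlgebra.mk c (tensorD c x i a) = 0 := by
    rw [NicholsAlgebra.mk_eq_zero_iff hc] at ha ⊢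
    exact fun n => (quantumSymmetrizer_succ_eq_zero_iff x n a).1 (ha (n + 1)) i
  have surj := NicholsAlgebra.mk_surjective c
  let ε : NicholsAlgebra c →ₐ[k] k := RingQuot.liftAlgHom k
    ⟨TensorAlgebra.algebraMapInv, fun a a' h => by
      rw [h.2, map_zero, ← quantumSymmetrizer_zero_eq_zero_iff (c := c), h.1 0]⟩
  have hε (a : TensorAlgebra k V) :
      ε (NicholsAlgebra.mk c a) = TensorAlgebra.algebraMapInv (R := k) (M := V) a :=
    RingQuot.liftAlgHom_mkAlgHom_apply k _ _ _
  have hτ' (i : I) (a : TensorAlgebra k V) :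
      NicholsAlgebra.descend (tensorTwist x b i).toLinearMap (hT i) (NicholsAlgebra.mk c a) =
        NicholsAlgebra.mk c (tensorTwist x b i a) :=
    NicholsAlgebra.descend_mk _ (hT i) a
  let τ (i : I) : NicholsAlgebra c →ₐ[k] NicholsAlgebra c :=
    AlgHom.ofLinearMap (NicholsAlgebra.descend (tensorTwist x b i).toLinearMap (hT i))
      (by
        rw [← map_one (NicholsAlgebra.mk c)]
        exact (hτ' i _).trans (by rw [map_one]))
      (fun p q => by
        obtain ⟨p, rfl⟩ := surj p
        obtain ⟨q, rfl⟩ := surj q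
        rw [← map_mul]
        refine (hτ' i _).trans ?_
        rw [map_mul, map_mul]
        exact congrArg₂ _ (hτ' i p).symm (hτ' i q).symm)
  have hτ (i : I) (a : TensorAlgebra k V) :
      τ i (NicholsAlgebra.mk c a) = NicholsAlgebra.mk c (tensorTwist x b i a) :=
    hτ' i a
  exact
  { counit := ε
    twist := τ
    D := fun i => NicholsAlgebra.descend (tensorD c x i) (hD i)
    counit_gen := fun i => (hε _).trans (by simp [TensorAlgebra.algebraMapInv])
    twist_gen := fun i j => (hτ i _).trans (by rw [tensorTwist_ι, map_smul]; rfl)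
    D_gen := fun i j => (NicholsAlgebra.descend_mk _ (hD i) _).trans (by
      rw [tensorD_ι hc]
      by_cases h : i = j
      · subst h; simp
      · simp [h])
    D_mul := fun i p q => by
      obtain ⟨p, rfl⟩ := surj p
      obtain ⟨q, rfl⟩ := surj q
      rw [← map_mul, NicholsAlgebra.descend_mk, NicholsAlgebra.descend_mk,
        NicholsAlgebra.descend_mk, hτ, tensorD_mul hc, map_add, map_mul, map_mul]
    eq_zero := fun a h0 h1 => by
      obtain ⟨a, rfl⟩ := surj a
      rw [NicholsAlgebra.mk_eq_zero_iff hc]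
      intro n
      cases n with
      | zero => rw [quantumSymmetrizer_zero_eq_zero_iff, ← hε, h0]
      | succ n =>
        rw [quantumSymmetrizer_succ_eq_zero_iff x]
        intro i
        refine (NicholsAlgebra.mk_eq_zero_iff hc _).1 ?_ n
        rw [← h1 i, NicholsAlgebra.descend_mk]
    adjoin_gen := by
      rw [eq_top_iff]
      rintro a -
      obtain ⟨a, rfl⟩ := surj a
      induction a using TensorAlgebra.induction with
      | algebraMap r => rw [AlgHom.commutes]; exact Subalgebra.algebraMap_mem _ r
      | mul p q hp hq => rw [map_mul]; exact mul_mem hp hq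
      | add p q hp hq => rw [map_add]; exact add_mem hp hq
      | ι v =>
        induction v using basis_induction x with
        | zero => simp
        | add v w hv hw => rw [map_add, map_add]; exact add_mem hv hw
        | smul r v hv => rw [map_smul, map_smul]; exact Subalgebra.smul_mem _ hv r
        | basis l => exact Algebra.subset_adjoin ⟨l, rfl⟩ }

omit [Fintype I] [DecidableEq I] in
theorem Ad_eq (hc : HasMatrix c x b) (i j : I) :
    NicholsAlgebra.Ad c (x i) (x j) =
      NicholsAlgebra.ι c (x i) * NicholsAlgebra.ι c (x j) -
        b i j • (NicholsAlgebra.ι c (x j) * NicholsAlgebra.ι c (x i)) := by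
  simp [NicholsAlgebra.Ad, hc i j]

end Quotient

/-! ### Linear algebra behind independence and spanning. -/

/-- A linear map lowering a grading strictly by one, injectively on a spanning family in each degree,
lifts linear independence from degree zero. -/
theorem linearIndependent_of_lowering {k M J : Type*} [Field k] [AddCommGroup M] [Module k M]
    [Fintype J] (D : M →ₗ[k] M) (v : ℕ → J → M) (coeff : ℕ → k) (N : ℕ)
    (h0 : ∀ j, D (v 0 j) = 0) (hs : ∀ n j, D (v (n + 1) j) = coeff n • v n j)
    (hne : ∀ n, n + 1 < N → coeff n ≠ 0) (hv : LinearIndependent k (v 0)) :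
    LinearIndependent k fun p : Fin N × J => v p.1 p.2 := by
  have key (N : ℕ) (hne : ∀ n, n + 1 < N → coeff n ≠ 0) (l : ℕ → J → k)
      (hl : ∑ n ∈ Finset.range N, ∑ j, l n j • v n j = 0) : ∀ n < N, ∀ j, l n j = 0 := by
    induction N generalizing l with
    | zero => intro n hn; omega
    | succ N ih =>
      -- D kills the degree-zero part of the relation and shifts the rest down by one. Induction
      -- removes all coefficients of positive degree, and independence of `v 0` removes the others.
      have h1 := congrArg D hl
      rw [Finset.sum_range_succ', map_add] at h1
      simp only [map_sum, map_smul, h0, hs, smul_zero, Finset.sum_const_zero, add_zero, map_zero,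
        smul_smul] at h1
      have h2 := ih (fun n hn => hne n (by omega)) (fun n j => l (n + 1) j * coeff n) h1
      have h3 : ∀ n < N, ∀ j, l (n + 1) j = 0 := fun n hn j =>
        (mul_eq_zero.1 (h2 n hn j)).resolve_right (hne n (by omega))
      rw [Finset.sum_range_succ', Finset.sum_eq_zero (fun n hn => Finset.sum_eq_zero fun j _ => by
        rw [h3 n (Finset.mem_range.1 hn), zero_smul]), zero_add] at hl
      intro n hn
      cases n with
      | zero => exact Fintype.linearIndependent_iff.1 hv _ hl
      | succ n => exact h3 n (by omega)
  rw [Fintype.linearIndependent_iff]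
  rintro l hl ⟨i, j⟩
  have h := key N hne (fun n j => if h : n < N then l (⟨n, h⟩, j) else 0)
    (by simpa [Finset.sum_range, Fintype.sum_prod_type] using hl) i i.2 j
  simpa using h

/-- A subspace containing `1` and stable under right multiplication by generators is everything. -/
theorem eq_top_of_mul_gen_mem {k I B : Type*} [Field k] [Ring B] [Algebra k B] {gen : I → B}
    (hgen : Algebra.adjoin k (Set.range gen) = ⊤) (W : Submodule k B) (h1 : 1 ∈ W)
    (h : ∀ w ∈ W, ∀ i, w * gen i ∈ W) : W = ⊤ := by
  have key : ∀ a : B, ∀ w ∈ W, w * a ∈ W := by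
    intro a
    have ha : a ∈ Algebra.adjoin k (Set.range gen) := hgen ▸ Algebra.mem_top
    induction ha using Algebra.adjoin_induction with
    | mem a ha => obtain ⟨i, rfl⟩ := ha; exact fun w hw => h w hw i
    | algebraMap r =>
      intro w hw
      rw [← Algebra.commutes, ← Algebra.smul_def]
      exact W.smul_mem r hw
    | add p q _ _ hp hq => intro w hw; rw [mul_add]; exact W.add_mem (hp w hw) (hq w hw)
    | mul p q _ _ hp hq => intro w hw; rw [← mul_assoc]; exact hq _ (hp w hw)
  rw [eq_top_iff]
  rintro a -
  rw [← one_mul a]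
  exact key a 1 h1

/-! ### Rank two: PBW monomials in x, z and y. -/

namespace SkewDerivationSystem

section

variable {k : Type*} [Field k] {I : Type*} {B : Type*} [Ring B] [Algebra k B]

/-- The braided commutator `y x - b_yx x y`. -/
def comm (b : Matrix I I k) (gen : I → B) (s t : I) : B :=
  gen t * gen s - b t s • (gen s * gen t)

/-- The self-braiding of `comm b gen s t`. -/
def commParam (b : Matrix I I k) (s t : I) : k := -(b s s * b s t * b t s)

end

variable {k : Type*} [Field k] {I : Type*} [DecidableEq I] {b : Matrix I I k}
  {B : Type*} [Ring B] [Algebra k B] {gen : I → B} (S : SkewDerivationSystem b gen)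

include S

theorem D_one (i : I) : S.D i 1 = 0 := by
  have h := S.D_mul i 1 1
  rw [map_one (S.twist i), mul_one, mul_one, one_mul] at h
  exact left_eq_add.1 h

theorem nontrivial : Nontrivial B := by
  refine ⟨1, 0, fun h => ?_⟩
  have := congrArg S.counit h
  simp at this

theorem D_gen_self (i : I) : S.D i (gen i) = 1 := by rw [S.D_gen, if_pos rfl]

theorem D_gen_of_ne {i j : I} (h : i ≠ j) : S.D i (gen j) = 0 := by rw [S.D_gen, if_neg h]

theorem D_pow_of_D_eq_zero {i : I} {a : B} (h : S.D i a = 0) (n : ℕ) : S.D i (a ^ n) = 0 := by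
  induction n with
  | zero => rw [pow_zero, S.D_one]
  | succ n ih => rw [pow_succ, S.D_mul, h, ih, mul_zero, zero_mul, add_zero]

theorem twist_gen_pow (i j : I) (n : ℕ) : S.twist i (gen j ^ n) = b i j ^ n • gen j ^ n := by
  rw [map_pow, S.twist_gen, smul_pow]

theorem D_gen_pow (i : I) (n : ℕ) :
    S.D i (gen i ^ (n + 1)) = (∑ m ∈ Finset.range (n + 1), b i i ^ m) • gen i ^ n := by
  induction n with
  | zero => simp [S.D_gen_self]
  | succ n ih =>
    rw [pow_succ', S.D_mul, ih, S.D_gen_self, one_mul, S.twist_gen_pow,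
      Finset.sum_range_succ _ (n + 1), add_smul, mul_smul_comm, ← pow_succ']

theorem gen_pow_eq_zero (i : I) (n : ℕ) (hn : ∑ m ∈ Finset.range (n + 1), b i i ^ m = 0) :
    gen i ^ (n + 1) = 0 := by
  apply S.eq_zero
  · rw [map_pow, S.counit_gen, zero_pow n.succ_ne_zero]
  · intro j
    by_cases h : j = i
    · rw [h, S.D_gen_pow, hn, zero_smul]
    · exact S.D_pow_of_D_eq_zero (S.D_gen_of_ne h) _

theorem gen_sq_eq_zero {i : I} (hi : b i i = -1) : gen i * gen i = 0 := by
  rw [← pow_two]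
  exact S.gen_pow_eq_zero i 1 (by simp [Finset.sum_range_succ, hi])

section RankTwo

variable {s t : I} (hst : s ≠ t) (ht : b t t = -1)

theorem counit_comm : S.counit (comm b gen s t) = 0 := by
  simp [comm, S.counit_gen]

include hst in
theorem D_comm_right : S.D t (comm b gen s t) = 0 := by
  simp [comm, S.D_mul, S.D_gen_self, S.D_gen_of_ne hst.symm, S.twist_gen]

include hst in
theorem D_comm_left : S.D s (comm b gen s t) = (1 - b s t * b t s) • gen t := by
  simp only [comm, map_sub, map_smul, S.D_mul, S.D_gen_self, S.D_gen_of_ne hst, S.twist_gen,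
    sub_smul, mul_smul, one_smul, mul_one, one_mul, zero_mul, mul_zero, add_zero, zero_add,
    smul_comm (b s t)]

theorem twist_comm (i : I) :
    S.twist i (comm b gen s t) = (b i s * b i t) • comm b gen s t := by
  simp only [comm, map_sub, map_smul, map_mul, S.twist_gen, smul_mul_smul_comm, smul_sub,
    smul_comm (b t s), mul_comm (b i t)]

-- Because y² = 0, both yz and zy reduce to multiples of yxy.
include ht in
theorem gen_mul_comm :
    gen t * comm b gen s t = (-b t s) • (comm b gen s t * gen t) := by
  have h := S.gen_sq_eq_zero ht
  have h1 : gen t * (gen t * gen s) = 0 := by rw [← mul_assoc, h, zero_mul]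
  simp only [comm, mul_sub, sub_mul, h1, mul_smul_comm, smul_mul_assoc, mul_assoc, h, mul_zero,
    smul_zero, sub_zero, zero_sub, neg_smul]

include ht in
theorem gen_mul_comm_pow (n : ℕ) :
    gen t * comm b gen s t ^ n = (-b t s) ^ n • (comm b gen s t ^ n * gen t) := by
  induction n with
  | zero => simp
  | succ n ih =>
    rw [pow_succ, ← mul_assoc, ih, smul_mul_assoc, mul_assoc, S.gen_mul_comm ht, mul_smul_comm,
      smul_smul, ← pow_succ, mul_assoc]

-- In the Leibniz term y · twist(z^n) the twist contributes (b_ss b_st)^n, and moving y past z^n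
-- contributes (-b_ts)^n. Together they give p^n.
include hst ht in
theorem D_comm_pow (n : ℕ) :
    S.D s (comm b gen s t ^ (n + 1)) =
      ((1 - b s t * b t s) * ∑ m ∈ Finset.range (n + 1), commParam b s t ^ m) •
        (comm b gen s t ^ n * gen t) := by
  induction n with
  | zero => simp [S.D_comm_left hst]
  | succ n ih =>
    rw [pow_succ', S.D_mul, ih, S.D_comm_left hst, map_pow, S.twist_comm, smul_pow,
      Finset.sum_range_succ _ (n + 1), mul_add, add_smul, mul_smul_comm, ← mul_assoc, ← pow_succ',
      smul_mul_smul_comm, S.gen_mul_comm_pow ht, smul_smul, mul_assoc, ← mul_pow]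
    congr 4
    simp only [commParam]; ring

include hst ht in
theorem comm_pow_eq_zero (hI : ∀ i, i = s ∨ i = t) (n : ℕ)
    (hn : (1 - b s t * b t s) * ∑ m ∈ Finset.range (n + 1), commParam b s t ^ m = 0) :
    comm b gen s t ^ (n + 1) = 0 := by
  apply S.eq_zero
  · rw [map_pow, S.counit_comm, zero_pow n.succ_ne_zero]
  · intro i
    rcases hI i with rfl | rfl
    · rw [S.D_comm_pow hst ht, hn, zero_smul]
    · exact S.D_pow_of_D_eq_zero (S.D_comm_right hst) _

include hst ht in
/-- The PBW monomials in `x`, `z = y x - b_yx x y` and `y` are linearly independent. -/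
theorem linearIndependent_pbw (M N : ℕ)
    (hM : ∀ n, n + 1 < M → ∑ m ∈ Finset.range (n + 1), b s s ^ m ≠ 0)
    (hN : ∀ n, n + 1 < N →
      (1 - b s t * b t s) * ∑ m ∈ Finset.range (n + 1), commParam b s t ^ m ≠ 0) :
    LinearIndependent k fun p : Fin 2 × Fin N × Fin M × Unit =>
      gen s ^ (p.2.2.1 : ℕ) * comm b gen s t ^ (p.2.1 : ℕ) * gen t ^ (p.1 : ℕ) := by
  have := S.nontrivial
  -- Each application of the lowering lemma adds one exponent: that of x by ∂_s, of z by ∂_t ∂_s, of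
  -- y by ∂_t. `Unit` indexes the starting monomial 1.
  have h0 : LinearIndependent k fun _ : Unit => gen s ^ 0 * comm b gen s t ^ 0 * gen t ^ 0 := by
    simp
  have h1 : LinearIndependent k fun p : Fin M × Unit =>
      gen s ^ (p.1 : ℕ) * comm b gen s t ^ 0 * gen t ^ 0 := by
    refine linearIndependent_of_lowering (S.D s)
      (fun n _ => gen s ^ n * comm b gen s t ^ 0 * gen t ^ 0) _ M ?_ ?_ hM h0
    · simp [S.D_one]
    · simp [S.D_gen_pow]
  have hDt (n m : ℕ) : S.D t (gen s ^ n * comm b gen s t ^ m) = 0 := by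
    rw [S.D_mul, S.D_pow_of_D_eq_zero (S.D_comm_right hst),
      S.D_pow_of_D_eq_zero (S.D_gen_of_ne hst.symm), mul_zero, zero_mul, add_zero]
  have hDt' (n m : ℕ) : S.D t (gen s ^ n * comm b gen s t ^ m * gen t) =
      gen s ^ n * comm b gen s t ^ m := by
    rw [S.D_mul, hDt, S.D_gen_self, mul_one, zero_mul, add_zero]
  -- The Leibniz term in which ∂_s hits the power of x contains no y, so ∂_t kills it. This is why
  -- ∂_t ∂_s, and not ∂_s alone, lowers the exponent of z.
  have hDsx (n m : ℕ) : S.D t (S.D s (gen s ^ n) * S.twist s (comm b gen s t ^ m)) = 0 := by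
    rw [map_pow (S.twist s), S.twist_comm, smul_pow, mul_smul_comm, map_smul]
    cases n with
    | zero => rw [pow_zero, S.D_one, zero_mul, map_zero, smul_zero]
    | succ n => rw [S.D_gen_pow, smul_mul_assoc, map_smul, hDt, smul_zero, smul_zero]
  have h2 : LinearIndependent k fun p : Fin N × Fin M × Unit =>
      gen s ^ (p.2.1 : ℕ) * comm b gen s t ^ (p.1 : ℕ) * gen t ^ 0 := by
    refine linearIndependent_of_lowering (S.D t ∘ₗ S.D s)
      (fun n (p : Fin M × Unit) => gen s ^ (p.1 : ℕ) * comm b gen s t ^ n * gen t ^ 0) _ N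
      ?_ ?_ hN h1
    · intro j
      have := hDsx j.1 0
      simp only [pow_zero, map_one, mul_one, LinearMap.comp_apply] at this ⊢
      exact this
    · intro n j
      simp only [pow_zero, mul_one, LinearMap.comp_apply]
      rw [S.D_mul, map_add, hDsx, add_zero, S.D_comm_pow hst ht, mul_smul_comm, map_smul,
        ← mul_assoc, hDt']
  -- The lowering identity is needed for every n. For n ≥ 1 the coefficient 0 is correct because
  -- y^(n+1) = 0, and it need only be nonzero at n = 0.
  refine linearIndependent_of_lowering (S.D t)
    (fun n (p : Fin N × Fin M × Unit) =>
      gen s ^ (p.2.1 : ℕ) * comm b gen s t ^ (p.1 : ℕ) * gen t ^ n) (fun n => if n = 0 then 1 else 0)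
    2 ?_ ?_ ?_ h2
  · intro j
    simpa using hDt _ _
  · intro n j
    cases n with
    | zero => simpa using hDt' _ _
    | succ n =>
      simp [pow_succ, mul_assoc, S.gen_sq_eq_zero ht]
  · intro n hn
    simp [show n = 0 by omega]

include hst in
/-- The relation between `z = y x - b_yx x y` and `x`. -/
theorem comm_mul_gen (hI : ∀ i, i = s ∨ i = t)
    (hq : (1 + b s s) * (1 - b s s * b s t * b t s) = 0) :
    comm b gen s t * gen s = (b s s * b t s) • (gen s * comm b gen s t) := by
  rw [← sub_eq_zero]
  apply S.eq_zero
  · simp [S.counit_gen]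
  · intro i
    rcases hI i with rfl | rfl
    · have hyx : gen t * gen i = comm b gen i t + b t i • (gen i * gen t) := by simp [comm]
      -- The derivative of the defect is a multiple of z. The multiple vanishes if b_ss = -1, when
      -- x² = 0, or if b_ss b_st b_ts = 1, when a relation of Serre type holds.
      have : S.D i (comm b gen i t * gen i - (b i i * b t i) • (gen i * comm b gen i t)) =
          ((1 + b i i) * (1 - b i i * b i t * b t i)) • comm b gen i t := by
        simp only [map_sub, map_smul, S.D_mul, S.D_gen_self, S.D_comm_left hst, S.twist_comm,
          S.twist_gen, smul_mul_assoc, mul_smul_comm, hyx, mul_one, one_mul]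
        module
      rw [this, hq, zero_smul]
    · simp [S.D_mul, S.D_comm_right hst, S.D_gen_of_ne hst.symm]

include hst in
theorem comm_pow_mul_gen (hI : ∀ i, i = s ∨ i = t)
    (hq : (1 + b s s) * (1 - b s s * b s t * b t s) = 0) (n : ℕ) :
    comm b gen s t ^ n * gen s = (b s s * b t s) ^ n • (gen s * comm b gen s t ^ n) := by
  induction n with
  | zero => simp
  | succ n ih =>
    rw [pow_succ', mul_assoc, ih, mul_smul_comm, ← mul_assoc, S.comm_mul_gen hst hI hq,
      smul_mul_assoc, smul_smul, ← pow_succ, mul_assoc, ← pow_succ']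

include hst ht in
/-- The PBW monomials span. -/
theorem span_pbw (hI : ∀ i, i = s ∨ i = t)
    (hq : (1 + b s s) * (1 - b s s * b s t * b t s) = 0) (M N : ℕ)
    (hM : gen s ^ M = 0) (hN : comm b gen s t ^ N = 0) :
    ⊤ ≤ Submodule.span k (Set.range fun p : Fin 2 × Fin N × Fin M × Unit =>
      gen s ^ (p.2.2.1 : ℕ) * comm b gen s t ^ (p.2.1 : ℕ) * gen t ^ (p.1 : ℕ)) := by
  set W := Submodule.span k (Set.range fun p : Fin 2 × Fin N × Fin M × Unit =>
      gen s ^ (p.2.2.1 : ℕ) * comm b gen s t ^ (p.2.1 : ℕ) * gen t ^ (p.1 : ℕ)) with hW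
  have hmem (m n l : ℕ) : gen s ^ m * comm b gen s t ^ n * gen t ^ l ∈ W := by
    by_cases hm : m < M
    · by_cases hn : n < N
      · by_cases hl : l < 2
        · exact Submodule.subset_span ⟨(⟨l, hl⟩, ⟨n, hn⟩, ⟨m, hm⟩, ()), rfl⟩
        · have : gen t ^ l = 0 :=
            pow_eq_zero_of_le (not_lt.1 hl) ((pow_two _).trans (S.gen_sq_eq_zero ht))
          simp [this]
      · simp [pow_eq_zero_of_le (not_lt.1 hn) hN]
    · simp [pow_eq_zero_of_le (not_lt.1 hm) hM]
  rw [eq_top_of_mul_gen_mem S.adjoin_gen W (by simpa using hmem 0 0 0)]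
  intro w hw i
  induction hw using Submodule.span_induction with
  | zero => simp
  | add v w _ _ hv hw => rw [add_mul]; exact W.add_mem hv hw
  | smul r v _ hv => rw [smul_mul_assoc]; exact W.smul_mem r hv
  | mem w hw =>
    obtain ⟨⟨l, n, m, _⟩, rfl⟩ := hw
    dsimp only
    rcases hI i with rfl | rfl
    · have hxz (m n : ℕ) : gen i ^ m * comm b gen i t ^ n * gen i =
          (b i i * b t i) ^ n • (gen i ^ (m + 1) * comm b gen i t ^ n) := by
        rw [mul_assoc, S.comm_pow_mul_gen hst hI hq, mul_smul_comm, ← mul_assoc, ← pow_succ]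
      have hyx : gen t * gen i = comm b gen i t + b t i • (gen i * gen t) := by simp [comm]
      obtain ⟨l, hl⟩ := l
      interval_cases l
      · have := hmem (m + 1) n 0
        simp only [pow_zero, mul_one] at this ⊢
        rw [hxz]
        exact W.smul_mem _ this
      -- Substituting yx = z + b_ts xy yields x^m z^(n+1) plus a multiple of x^(m+1) z^n y.
      · have h1 := hmem m (n + 1) 0
        have h2 := hmem (m + 1) n 1
        simp only [pow_zero, pow_one, mul_one] at h1 h2 ⊢
        rw [mul_assoc, hyx, mul_add, mul_assoc, ← pow_succ, mul_smul_comm, ← mul_assoc _ (gen i),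
          hxz, smul_mul_assoc]
        exact W.add_mem h1 (W.smul_mem _ (W.smul_mem _ h2))
    · rw [mul_assoc, ← pow_succ]
      exact hmem _ _ _

include hst ht in
theorem rank_eq (hI : ∀ i, i = s ∨ i = t)
    (hq : (1 + b s s) * (1 - b s s * b s t * b t s) = 0) (M N : ℕ)
    (hM : ∀ n, n + 1 < M → ∑ m ∈ Finset.range (n + 1), b s s ^ m ≠ 0)
    (hN : ∀ n, n + 1 < N →
      (1 - b s t * b t s) * ∑ m ∈ Finset.range (n + 1), commParam b s t ^ m ≠ 0)
    (hM' : gen s ^ M = 0) (hN' : comm b gen s t ^ N = 0) :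
    Module.rank k B = (2 * N * M : ℕ) := by
  rw [rank_eq_card_basis (Module.Basis.mk (S.linearIndependent_pbw hst ht M N hM hN)
    (S.span_pbw hst ht hI hq M N hM' hN'))]
  simp [mul_assoc]

include hst ht in
theorem le_rank (M N : ℕ)
    (hM : ∀ n, n + 1 < M → ∑ m ∈ Finset.range (n + 1), b s s ^ m ≠ 0)
    (hN : ∀ n, n + 1 < N →
      (1 - b s t * b t s) * ∑ m ∈ Finset.range (n + 1), commParam b s t ^ m ≠ 0) :
    (2 * N * M : ℕ) ≤ Module.rank k B := by
  have := (S.linearIndependent_pbw hst ht M N hM hN).cardinal_lift_le_rank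
  simpa [mul_assoc] using this

include hst ht in
theorem comm_pow_ne_zero (N : ℕ)
    (hN : ∀ n, n < N →
      (1 - b s t * b t s) * ∑ m ∈ Finset.range (n + 1), commParam b s t ^ m ≠ 0) :
    comm b gen s t ^ N ≠ 0 := by
  -- Taking M = 1 makes the condition on b_ss vacuous.
  have := (S.linearIndependent_pbw hst ht 1 (N + 1) (by omega)
    (fun n hn => hN n (by omega))).ne_zero (0, Fin.last N, 0, ())
  simpa using this

theorem gen_pow_ne_zero (i : I) (N : ℕ)
    (hN : ∀ n, n < N → ∑ m ∈ Finset.range (n + 1), b i i ^ m ≠ 0) : gen i ^ N ≠ 0 := by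
  have := S.nontrivial
  induction N with
  | zero => simp
  | succ N ih =>
    intro h
    have h1 := S.D_gen_pow i N
    rw [h, map_zero] at h1
    exact (smul_ne_zero (hN N (by omega)) (ih fun n hn => hN n (by omega))) h1.symm

end RankTwo

end SkewDerivationSystem

/-! ### Nilpotency orders, and quantum linear spaces of rank three. -/

theorem nilpotencyOrder_eq {A : Type*} [Ring A] {w : A} {n : ℕ} (h : w ^ (n + 1) = 0)
    (h' : w ^ n ≠ 0) : nilpotencyOrder w = (n + 1 : ℕ) := by
  rw [nilpotencyOrder, if_pos ⟨_, h⟩, nilpotencyClass_eq_succ_iff.2 ⟨h, h'⟩]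

theorem nilpotencyOrder_eq_top {A : Type*} [Ring A] {w : A} (h : ∀ n, w ^ n ≠ 0) :
    nilpotencyOrder w = ⊤ := by
  rw [nilpotencyOrder, if_neg]
  rintro ⟨n, hn⟩
  exact h n hn

theorem pow_mul_of_mul_eq_smul {k A : Type*} [Field k] [Ring A] [Algebra k A] {a a' : A} {q : k}
    (h : a' * a = q • (a * a')) (n : ℕ) : a' ^ n * a = q ^ n • (a * a' ^ n) := by
  induction n with
  | zero => simp
  | succ n ih =>
    rw [pow_succ', mul_assoc, ih, mul_smul_comm, ← mul_assoc, h, smul_mul_assoc, smul_smul,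
      ← pow_succ, mul_assoc]

/-- The ordered monomials span an algebra satisfying the relations of a quantum linear space. -/
theorem span_quantumLinear {k A : Type*} [Field k] [Ring A] [Algebra k A] {g : Fin 3 → A}
    (hgen : Algebra.adjoin k (Set.range g) = ⊤) {q₁ q₂ q₃ : k} (hsq : ∀ i, g i ^ 2 = 0)
    (h10 : g 1 * g 0 = q₁ • (g 0 * g 1)) (h20 : g 2 * g 0 = q₃ • (g 0 * g 2))
    (h21 : g 2 * g 1 = q₂ • (g 1 * g 2)) :
    ⊤ ≤ Submodule.span k (Set.range fun n : Fin 2 × Fin 2 × Fin 2 =>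
      g 0 ^ (n.1 : ℕ) * g 1 ^ (n.2.1 : ℕ) * g 2 ^ (n.2.2 : ℕ)) := by
  set W := Submodule.span k (Set.range fun n : Fin 2 × Fin 2 × Fin 2 =>
      g 0 ^ (n.1 : ℕ) * g 1 ^ (n.2.1 : ℕ) * g 2 ^ (n.2.2 : ℕ)) with hW
  have hpow (i : Fin 3) (n : ℕ) (hn : ¬ n < 2) : g i ^ n = 0 :=
    pow_eq_zero_of_le (not_lt.1 hn) (hsq i)
  have hmem (m n l : ℕ) : g 0 ^ m * g 1 ^ n * g 2 ^ l ∈ W := by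
    by_cases hm : m < 2
    · by_cases hn : n < 2
      · by_cases hl : l < 2
        · exact Submodule.subset_span ⟨(⟨m, hm⟩, ⟨n, hn⟩, ⟨l, hl⟩), rfl⟩
        · simp [hpow 2 l hl]
      · simp [hpow 1 n hn]
    · simp [hpow 0 m hm]
  rw [eq_top_of_mul_gen_mem hgen W (by simpa using hmem 0 0 0)]
  intro w hw i
  induction hw using Submodule.span_induction with
  | zero => simp
  | add v w _ _ hv hw => rw [add_mul]; exact W.add_mem hv hw
  | smul r v _ hv => rw [smul_mul_assoc]; exact W.smul_mem r hv
  | mem w hw =>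
    obtain ⟨⟨m, n, l⟩, rfl⟩ := hw
    dsimp only
    fin_cases i <;> dsimp only [Fin.zero_eta, Fin.mk_one, Fin.reduceFinMk]
    · have h : g 0 ^ (m : ℕ) * g 1 ^ (n : ℕ) * g 2 ^ (l : ℕ) * g 0 =
          (q₃ ^ (l : ℕ) * q₁ ^ (n : ℕ)) •
            (g 0 ^ (m + 1 : ℕ) * g 1 ^ (n : ℕ) * g 2 ^ (l : ℕ)) := by
        rw [mul_assoc, pow_mul_of_mul_eq_smul h20, mul_smul_comm, ← mul_assoc,
          mul_assoc _ _ (g 0), pow_mul_of_mul_eq_smul h10, mul_smul_comm, smul_mul_assoc,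
          smul_smul, ← mul_assoc, ← pow_succ]
      rw [h]
      exact W.smul_mem _ (hmem _ _ _)
    · rw [mul_assoc, pow_mul_of_mul_eq_smul h21, mul_smul_comm, ← mul_assoc, mul_assoc _ _ (g 1),
        ← pow_succ]
      exact W.smul_mem _ (hmem _ _ _)
    · rw [mul_assoc, ← pow_succ]
      exact hmem _ _ _

namespace SkewDerivationSystem

variable {k : Type*} [Field k]

/-- Every derivative of the difference vanishes; only ∂_i uses b_ij b_ji = 1. -/
theorem gen_mul_gen {I : Type*} [DecidableEq I] {b : Matrix I I k}
    {B : Type*} [Ring B] [Algebra k B] {gen : I → B} (S : SkewDerivationSystem b gen)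
    {i j : I} (hij : i ≠ j) (h : b i j * b j i = 1) :
    gen j * gen i = b j i • (gen i * gen j) := by
  rw [← sub_eq_zero]
  apply S.eq_zero
  · simp [S.counit_gen]
  · intro l
    have h' : b j i * b i j = 1 := by rw [mul_comm, h]
    by_cases hi : l = i
    · subst hi
      simp [S.D_mul, S.D_gen_self, S.D_gen_of_ne hij, S.twist_gen, smul_smul, h']
    · by_cases hj : l = j
      · subst hj
        simp [S.D_mul, S.D_gen_self, S.D_gen_of_ne hi, S.twist_gen]
      · simp [S.D_mul, S.D_gen_of_ne hi, S.D_gen_of_ne hj]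

theorem linearIndependent_quantumLinear {b : Matrix (Fin 3) (Fin 3) k}
    {B : Type*} [Ring B] [Algebra k B] {gen : Fin 3 → B} (S : SkewDerivationSystem b gen)
    (hb : ∀ i, b i i = -1) :
    LinearIndependent k fun n : Fin 2 × Fin 2 × Fin 2 =>
      gen 0 ^ (n.1 : ℕ) * gen 1 ^ (n.2.1 : ℕ) * gen 2 ^ (n.2.2 : ℕ) := by
  have := S.nontrivial
  have hD (i : Fin 3) (w : B) (hw : S.D i w = 0) (n : ℕ) :
      S.D i (w * gen i ^ (n + 1)) = (if n = 0 then 1 else 0 : k) • (w * gen i ^ n) := by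
    cases n with
    | zero => simp [S.D_mul, S.D_gen_self, hw]
    | succ n => simp [pow_succ, mul_assoc, S.gen_sq_eq_zero (hb i)]
  have hne : ∀ n, n + 1 < 2 → (if n = 0 then 1 else 0 : k) ≠ 0 := by
    intro n hn
    simp [show n = 0 by omega]
  have hpow (i j : Fin 3) (hij : i ≠ j) (n : ℕ) : S.D i (gen j ^ n) = 0 :=
    S.D_pow_of_D_eq_zero (S.D_gen_of_ne hij) n
  have h0 : LinearIndependent k fun _ : Unit => (1 : B) * gen 0 ^ 0 := by simp
  have h1 : LinearIndependent k fun p : Fin 2 × Unit => (1 : B) * gen 0 ^ (p.1 : ℕ) :=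
    linearIndependent_of_lowering (S.D 0) (fun n _ => 1 * gen 0 ^ n) _ 2
      (fun _ => by simp [S.D_one]) (fun n _ => hD 0 1 (S.D_one 0) n) hne h0
  have h2 : LinearIndependent k fun p : Fin 2 × Fin 2 × Unit =>
      gen 0 ^ (p.2.1 : ℕ) * gen 1 ^ (p.1 : ℕ) :=
    linearIndependent_of_lowering (S.D 1)
      (fun n (p : Fin 2 × Unit) => gen 0 ^ (p.1 : ℕ) * gen 1 ^ n) _ 2
      (fun _ => by simp [hpow 1 0]) (fun n _ => hD 1 _ (hpow 1 0 (by decide) _) n) hne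
      (by simpa using h1)
  have h3 : LinearIndependent k fun p : Fin 2 × Fin 2 × Fin 2 × Unit =>
      gen 0 ^ (p.2.2.1 : ℕ) * gen 1 ^ (p.2.1 : ℕ) * gen 2 ^ (p.1 : ℕ) := by
    have hz (m n : ℕ) : S.D 2 (gen 0 ^ m * gen 1 ^ n) = 0 := by
      simp [S.D_mul, hpow 2 0, hpow 2 1]
    exact linearIndependent_of_lowering (S.D 2)
      (fun n (p : Fin 2 × Fin 2 × Unit) => gen 0 ^ (p.2.1 : ℕ) * gen 1 ^ (p.1 : ℕ) * gen 2 ^ n) _ 2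
      (fun _ => by simp [hz]) (fun n _ => hD 2 _ (hz _ _) n) hne (by simpa using h2)
  exact h3.comp (fun n : Fin 2 × Fin 2 × Fin 2 => (n.2.2, n.2.1, n.1, ()))
    (fun n n' h => by simp only [Prod.mk.injEq] at h; ext <;> simp [h])

end SkewDerivationSystem

/-- Presentation of an algebra by the relations of a quantum linear space, given that the ordered
monomials are linearly independent. -/
theorem ker_lift_eq_span {k A : Type*} [Field k] [Ring A] [Algebra k A] {g : Fin 3 → A}
    {q₁ q₂ q₃ : k} (hsq : ∀ i, g i ^ 2 = 0)
    (h10 : g 1 * g 0 = q₁ • (g 0 * g 1)) (h20 : g 2 * g 0 = q₃ • (g 0 * g 2))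
    (h21 : g 2 * g 1 = q₂ • (g 1 * g 2))
    (hli : LinearIndependent k fun n : Fin 2 × Fin 2 × Fin 2 =>
      g 0 ^ (n.1 : ℕ) * g 1 ^ (n.2.1 : ℕ) * g 2 ^ (n.2.2 : ℕ)) :
    TwoSidedIdeal.ker (FreeAlgebra.lift k g) =
      TwoSidedIdeal.span (let X := FreeAlgebra.ι k (X := Fin 3)
        {X 0 ^ 2, X 1 ^ 2, X 2 ^ 2, X 1 * X 0 - q₁ • (X 0 * X 1),
          X 2 * X 0 - q₃ • (X 0 * X 2), X 2 * X 1 - q₂ • (X 1 * X 2)}) := by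
  dsimp only
  set R : Set (FreeAlgebra k (Fin 3)) := {FreeAlgebra.ι k 0 ^ 2, _, _, _, _, _} with hR
  set J := TwoSidedIdeal.span R with hJ
  have hle : J ≤ TwoSidedIdeal.ker (FreeAlgebra.lift k g) := by
    rw [hJ, TwoSidedIdeal.span_le]
    intro f hf
    rw [SetLike.mem_coe, TwoSidedIdeal.mem_ker]
    simp only [hR, Set.mem_insert_iff, Set.mem_singleton_iff] at hf
    rcases hf with rfl | rfl | rfl | rfl | rfl | rfl <;> simp [hsq, h10, h20, h21]
  apply le_antisymm _ hle
  let π : FreeAlgebra k (Fin 3) →ₐ[k] J.ringCon.Quotient := RingCon.mkₐ k J.ringCon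
  have hπ (f : FreeAlgebra k (Fin 3)) : π f = 0 ↔ f ∈ J := by
    conv_rhs => rw [← TwoSidedIdeal.ker_ringCon_mk' J]
    rw [TwoSidedIdeal.mem_ker]
    rfl
  have hrel (f : FreeAlgebra k (Fin 3)) (hf : f ∈ R) : π f = 0 :=
    (hπ f).2 (TwoSidedIdeal.subset_span hf)
  have hspan := span_quantumLinear (k := k) (g := fun i => π (FreeAlgebra.ι k i)) (q₁ := q₁)
    (q₂ := q₂) (q₃ := q₃)
    (by
      rw [Set.range_comp', ← AlgHom.map_adjoin, FreeAlgebra.adjoin_range_ι, Algebra.map_top,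
        AlgHom.range_eq_top]
      exact Quotient.mk_surjective)
    (fun i => by
      rw [← map_pow]
      fin_cases i <;> exact hrel _ (by simp [hR]))
    (by rw [← sub_eq_zero, ← map_mul, ← map_mul, ← map_smul, ← map_sub]
        exact hrel _ (by simp [hR]))
    (by rw [← sub_eq_zero, ← map_mul, ← map_mul, ← map_smul, ← map_sub]
        exact hrel _ (by simp [hR]))
    (by rw [← sub_eq_zero, ← map_mul, ← map_mul, ← map_smul, ← map_sub]
        exact hrel _ (by simp [hR]))
  intro f hf
  obtain ⟨l, hl⟩ := (Submodule.mem_span_range_iff_exists_fun k).1 (hspan (Submodule.mem_top (x := π f)))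
  -- f' is a combination of ordered monomials congruent to f modulo J. If f maps to zero in A then
  -- so does f', and independence in A forces all its coefficients to vanish.
  let f' : FreeAlgebra k (Fin 3) := ∑ n : Fin 2 × Fin 2 × Fin 2, l n •
    (FreeAlgebra.ι k 0 ^ (n.1 : ℕ) * FreeAlgebra.ι k 1 ^ (n.2.1 : ℕ) *
      FreeAlgebra.ι k 2 ^ (n.2.2 : ℕ))
  have hf' : π f' = π f := by
    rw [← hl]
    simp only [f', map_sum, map_smul, map_mul, map_pow]
  have h1 : f' - f ∈ J := by rw [← hπ, map_sub, hf', sub_self]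
  have h2 := hle h1
  rw [TwoSidedIdeal.mem_ker] at h2 hf
  rw [map_sub, hf, sub_zero] at h2
  simp only [f', map_sum, map_smul, map_mul, map_pow, FreeAlgebra.lift_ι_apply] at h2
  have h3 := Fintype.linearIndependent_iff.1 hli l h2
  rw [← hπ, ← hl]
  simp [h3]

theorem quantumLinearSpace {k V : Type*} [Field k] [AddCommGroup V] [Module k V]
    {c : V ⊗[k] V →ₗ[k] V ⊗[k] V} {x : Module.Basis (Fin 3) k V} {q₁ q₂ q₃ : kˣ}
    (hc : HasMatrix c x (b1three q₁ q₂ q₃)) :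
    IsQuantumLinear (b1three q₁ q₂ q₃) ∧ Module.rank k (NicholsAlgebra c) = 8 ∧
    (∃ B : Module.Basis (Fin 2 × Fin 2 × Fin 2) k (NicholsAlgebra c), ∀ n, B n =
      NicholsAlgebra.ι c (x 0) ^ (n.1 : ℕ) * NicholsAlgebra.ι c (x 1) ^ (n.2.1 : ℕ) *
        NicholsAlgebra.ι c (x 2) ^ (n.2.2 : ℕ)) ∧
    Function.Surjective (FreeAlgebra.lift k fun i => NicholsAlgebra.ι c (x i)) ∧
    TwoSidedIdeal.ker (FreeAlgebra.lift k fun i => NicholsAlgebra.ι c (x i)) =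
      TwoSidedIdeal.span (let X := FreeAlgebra.ι k (X := Fin 3)
        {X 0 ^ 2, X 1 ^ 2, X 2 ^ 2,
          X 1 * X 0 - (q₁ : k) • (X 0 * X 1),
          X 2 * X 0 - (q₃ : k) • (X 0 * X 2),
          X 2 * X 1 - (q₂ : k) • (X 1 * X 2)}) := by
  let S := nicholsSystem hc
  have hlin : IsQuantumLinear (b1three q₁ q₂ q₃) := by
    intro i j hij
    fin_cases i <;> fin_cases j <;> simp [b1three] at hij ⊢
  have hdiag (i : Fin 3) : b1three q₁ q₂ q₃ i i = -1 := by fin_cases i <;> rfl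
  have hsq (i : Fin 3) : NicholsAlgebra.ι c (x i) ^ 2 = 0 := by
    rw [pow_two]; exact S.gen_sq_eq_zero (hdiag i)
  have h10 := S.gen_mul_gen (i := 0) (j := 1) (by decide) (hlin 0 1 (by decide))
  have h20 := S.gen_mul_gen (i := 0) (j := 2) (by decide) (hlin 0 2 (by decide))
  have h21 := S.gen_mul_gen (i := 1) (j := 2) (by decide) (hlin 1 2 (by decide))
  have hli := S.linearIndependent_quantumLinear hdiag
  have hspan := span_quantumLinear S.adjoin_gen hsq h10 h20 h21
  refine ⟨hlin, ?_, ⟨Module.Basis.mk hli hspan, fun n => by rw [Module.Basis.mk_apply]⟩, ?_,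
    ker_lift_eq_span hsq h10 h20 h21 hli⟩
  · rw [rank_eq_card_basis (Module.Basis.mk hli hspan)]
    simp only [Fintype.card_prod, Fintype.card_fin]
    norm_num
  · rw [← AlgHom.range_eq_top, ← Algebra.map_top, ← FreeAlgebra.adjoin_range_ι, AlgHom.map_adjoin,
      ← S.adjoin_gen, ← Set.range_comp]
    congr 2
    ext i
    simp

/-! ### Rank two: dimensions and nilpotency orders from orders of roots of unity. -/

theorem geom_sum_ne_zero_of_isPrimitiveRoot {k : Type*} [Field k] {p : k} {N : ℕ}
    (h : IsPrimitiveRoot p N) (n : ℕ) (hn : n + 1 < N) :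
    ∑ m ∈ Finset.range (n + 1), p ^ m ≠ 0 := by
  intro h0
  have h1 := geom_sum_mul p (n + 1)
  rw [h0, zero_mul, eq_comm, sub_eq_zero] at h1
  exact h.pow_ne_one_of_pos_of_lt n.succ_ne_zero hn h1

theorem isPrimitiveRoot_neg_one {k : Type*} [Field k] (hchar : ringChar k ≠ 2) :
    IsPrimitiveRoot (-1 : k) 2 :=
  IsPrimitiveRoot.neg_one (ringChar k) hchar

section

variable {k V : Type*} [Field k] [AddCommGroup V] [Module k V]
  {c : V ⊗[k] V →ₗ[k] V ⊗[k] V} {I : Type*} [Fintype I] [DecidableEq I] {x : Module.Basis I k V}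
  {b : Matrix I I k}

theorem nilpotencyOrder_gen (hc : HasMatrix c x b) (i : I) {N : ℕ} (hN : 1 < N)
    (h : IsPrimitiveRoot (b i i) N) : nilpotencyOrder (NicholsAlgebra.ι c (x i)) = N := by
  let S := nicholsSystem hc
  obtain ⟨n, rfl⟩ : ∃ n, N = n + 1 := ⟨N - 1, by omega⟩
  exact nilpotencyOrder_eq (S.gen_pow_eq_zero i n (h.geom_sum_eq_zero hN))
    (S.gen_pow_ne_zero i n fun m hm => geom_sum_ne_zero_of_isPrimitiveRoot h m (by omega))

omit [Fintype I] [DecidableEq I] in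
theorem Ad_eq_comm (hc : HasMatrix c x b) (s t : I) :
    NicholsAlgebra.Ad c (x t) (x s) =
      SkewDerivationSystem.comm b (fun i => NicholsAlgebra.ι c (x i)) s t :=
  Ad_eq hc t s

/-- Nichols algebras of rank two of super type `A₂`, or with two generators squaring to zero. -/
theorem rank_and_nilpotencyOrder_Ad (hc : HasMatrix c x b) {s t : I} (hst : s ≠ t)
    (hI : ∀ i, i = s ∨ i = t) (ht : b t t = -1) (hne : b s t * b t s ≠ 1)
    (hq : (1 + b s s) * (1 - b s s * b s t * b t s) = 0) {M N : ℕ} (hM : 1 < M) (hN : 1 < N)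
    (hs : IsPrimitiveRoot (b s s) M)
    (hp : IsPrimitiveRoot (SkewDerivationSystem.commParam b s t) N) :
    Module.rank k (NicholsAlgebra c) = (2 * N * M : ℕ) ∧
      nilpotencyOrder (NicholsAlgebra.Ad c (x t) (x s)) = N := by
  let S := nicholsSystem hc
  obtain ⟨m, rfl⟩ : ∃ m, M = m + 1 := ⟨M - 1, by omega⟩
  obtain ⟨n, rfl⟩ : ∃ n, N = n + 1 := ⟨N - 1, by omega⟩
  have hne' : 1 - b s t * b t s ≠ 0 := sub_ne_zero.2 hne.symm
  have hcomm := S.comm_pow_eq_zero hst ht hI n (by rw [hp.geom_sum_eq_zero hN, mul_zero])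
  refine ⟨S.rank_eq hst ht hI hq (m + 1) (n + 1)
    (fun i hi => geom_sum_ne_zero_of_isPrimitiveRoot hs i hi)
    (fun i hi => mul_ne_zero hne' (geom_sum_ne_zero_of_isPrimitiveRoot hp i hi))
    (S.gen_pow_eq_zero s m (hs.geom_sum_eq_zero hM)) hcomm, ?_⟩
  rw [Ad_eq_comm hc]
  exact nilpotencyOrder_eq hcomm (S.comm_pow_ne_zero hst ht n fun i hi =>
    mul_ne_zero hne' (geom_sum_ne_zero_of_isPrimitiveRoot hp i (by omega)))

end

section

variable {k V : Type*} [Field k] [AddCommGroup V] [Module k V]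
  {c : V ⊗[k] V →ₗ[k] V ⊗[k] V} {x : Module.Basis (Fin 2) k V} {b : Matrix (Fin 2) (Fin 2) k}

theorem eq_zero_or_one (i : Fin 2) : i = 0 ∨ i = 1 := by omega

theorem eq_one_or_zero (i : Fin 2) : i = 1 ∨ i = 0 := by omega

/-- Both generators square to zero and `b₁₂ b₂₁` has order `N`. -/
theorem nichols_of_diag_neg_one (hchar : ringChar k ≠ 2) (hc : HasMatrix c x b)
    (h0 : b 0 0 = -1) (h1 : b 1 1 = -1) {N : ℕ} (hN : 1 < N)
    (hr : IsPrimitiveRoot (b 0 1 * b 1 0) N) :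
    Module.rank k (NicholsAlgebra c) = (2 * N * 2 : ℕ) ∧
      nilpotencyOrder (NicholsAlgebra.ι c (x 0)) = 2 ∧
      nilpotencyOrder (NicholsAlgebra.ι c (x 1)) = 2 ∧
      nilpotencyOrder (NicholsAlgebra.Ad c (x 0) (x 1)) = N ∧
      nilpotencyOrder (NicholsAlgebra.Ad c (x 1) (x 0)) = N := by
  have h2 := isPrimitiveRoot_neg_one hchar
  have hne := hr.ne_one hN
  -- With b_ss = -1 the parameter p equals b_st b_ts and the spanning condition is automatic. Both
  -- assignments of the roles are used, one for each adjoint action.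
  have h01 := rank_and_nilpotencyOrder_Ad hc (s := 0) (t := 1) (by decide) eq_zero_or_one h1 hne
    (by rw [h0]; ring) one_lt_two hN (h0 ▸ h2)
    (by simpa [SkewDerivationSystem.commParam, h0] using hr)
  have h10 := rank_and_nilpotencyOrder_Ad hc (s := 1) (t := 0) (by decide) eq_one_or_zero h0
    (by rwa [mul_comm]) (by rw [h1]; ring) one_lt_two hN (h1 ▸ h2)
    (by simpa [SkewDerivationSystem.commParam, h1, mul_comm] using hr)
  exact ⟨h01.1, nilpotencyOrder_gen hc 0 one_lt_two (h0 ▸ h2),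
    nilpotencyOrder_gen hc 1 one_lt_two (h1 ▸ h2), h10.2, h01.2⟩

theorem nichols_b1 (hchar : ringChar k ≠ 2) {q : kˣ} (hc : HasMatrix c x (b1 q)) :
    Module.rank k (NicholsAlgebra c) = 4 ∧ IsCartanType (b1 q) ∧
      NicholsAlgebra.Ad c (x 0) (x 1) = 0 ∧ NicholsAlgebra.Ad c (x 1) (x 0) = 0 ∧
      nilpotencyOrder (NicholsAlgebra.ι c (x 0)) = 2 ∧
      nilpotencyOrder (NicholsAlgebra.ι c (x 1)) = 2 := by
  let S := nicholsSystem hc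
  have h2 := isPrimitiveRoot_neg_one hchar
  have h00 : b1 q 0 0 = -1 := rfl
  have h11 : b1 q 1 1 = -1 := rfl
  have h01 : b1 q 0 1 * b1 q 1 0 = 1 := by simp [b1]
  have h10 : b1 q 1 0 * b1 q 0 1 = 1 := by simp [b1]
  -- The factor 1 - b_st b_ts is zero, so z itself vanishes and N = 1.
  have hz := S.comm_pow_eq_zero (s := 0) (t := 1) (by decide) h11 eq_zero_or_one 0 (by simp [h01])
  have hz' := S.comm_pow_eq_zero (s := 1) (t := 0) (by decide) h00 eq_one_or_zero 0 (by simp [h10])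
  refine ⟨?_, ⟨!![2, 0; 0, 2], fun i j => ?_⟩, ?_, ?_,
    nilpotencyOrder_gen hc 0 one_lt_two h2, nilpotencyOrder_gen hc 1 one_lt_two h2⟩
  · rw [S.rank_eq (s := 0) (t := 1) (by decide) h11 eq_zero_or_one (by rw [h00]; ring) 2 1
      (fun n hn => geom_sum_ne_zero_of_isPrimitiveRoot (h00 ▸ h2) n hn) (by omega)
      (by rw [pow_two]; exact S.gen_sq_eq_zero h00) hz]
    norm_num
  · fin_cases i <;> fin_cases j <;> simp [b1]
  · rw [Ad_eq_comm hc, ← hz', zero_add, pow_one]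
  · rw [Ad_eq_comm hc, ← hz, zero_add, pow_one]

/-- A non-Cartan criterion: a diagonal entry `-1` and a product `b₁₂ b₂₁` that is not a sign. -/
theorem not_isCartanType {i j : Fin 2} (hi : b i i = -1) (h : (b i j * b j i) ^ 2 ≠ 1) :
    ¬ IsCartanType b := by
  rintro ⟨a, ha⟩
  apply h
  rw [ha, hi, ← zpow_natCast, ← zpow_mul, mul_comm, zpow_mul]
  simp

theorem rootOrder_one : rootOrder (1 : kˣ) = if ringChar k = 0 then ⊤ else (ringChar k : ℕ∞) := by
  simp [rootOrder]

theorem ringChar_three_le (hchar : ringChar k ≠ 2) (h0 : ringChar k ≠ 0) : 3 ≤ ringChar k := by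
  have := ((CharP.char_is_prime_or_zero k (ringChar k)).resolve_right h0).two_le
  omega

/-- Here p = -j² = 1, so the geometric sums are the integers n + 1 and vanish only modulo the
characteristic. The spanning condition fails, as (1 + j)(1 - j²) = 2(1 + j) ≠ 0, so only
independence of the monomials is available. -/
theorem nichols_b5 (hchar : ringChar k ≠ 2) {j : k} (hj : IsPrimitiveRoot j 4)
    (hc : HasMatrix c x (b5 j)) :
    8 * rootOrder (1 : kˣ) ≤ Cardinal.toENat (Module.rank k (NicholsAlgebra c)) ∧
      nilpotencyOrder (NicholsAlgebra.Ad c (x 1) (x 0)) = rootOrder (1 : kˣ) := by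
  let S := nicholsSystem hc
  have h4 : IsPrimitiveRoot (b5 j 0 0) 4 := hj
  have h11 : b5 j 1 1 = -1 := rfl
  have h01 : b5 j 0 1 * b5 j 1 0 = j := by simp [b5]
  have hjj : j * j = -1 := by
    have h : IsPrimitiveRoot (j ^ 2) 2 := hj.pow (by norm_num) (by norm_num)
    rw [← pow_two]; exact h.eq_neg_one_of_two_right
  have hp : SkewDerivationSystem.commParam (b5 j) 0 1 = 1 := by
    simp [SkewDerivationSystem.commParam, b5, hjj]
  have hne : 1 - b5 j 0 1 * b5 j 1 0 ≠ 0 := by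
    rw [h01]; exact sub_ne_zero.2 (hj.ne_one (by norm_num)).symm
  have hsum (n : ℕ) (h : ringChar k = 0 ∨ n + 1 < ringChar k) :
      (1 - b5 j 0 1 * b5 j 1 0) *
        ∑ m ∈ Finset.range (n + 1), SkewDerivationSystem.commParam (b5 j) 0 1 ^ m ≠ 0 := by
    refine mul_ne_zero hne ?_
    simp only [hp, one_pow, Finset.sum_const, Finset.card_range, nsmul_eq_mul, mul_one]
    rw [Ne, ringChar.spec]
    intro hd
    rcases h with h | h
    · rw [h] at hd; omega
    · exact absurd (Nat.le_of_dvd n.succ_pos hd) (by omega)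
  have hrank (N : ℕ) (h : ringChar k = 0 ∨ N ≤ ringChar k) :
      ((8 * N : ℕ) : ℕ∞) ≤ Cardinal.toENat (Module.rank k (NicholsAlgebra c)) := by
    have := S.le_rank (s := 0) (t := 1) (by decide) h11 4 N
      (geom_sum_ne_zero_of_isPrimitiveRoot h4) (fun n hn => hsum n (by omega))
    rw [show 2 * N * 4 = 8 * N by ring] at this
    simpa using Cardinal.toENat.monotone' this
  rw [rootOrder_one, Ad_eq_comm hc]
  by_cases h0 : ringChar k = 0
  · rw [if_pos h0]
    constructor
    · have htop : Cardinal.toENat (Module.rank k (NicholsAlgebra c)) = ⊤ :=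
        ENat.eq_top_iff_forall_ge.2 fun m =>
          le_trans (by exact_mod_cast (by omega : m ≤ 8 * m)) (hrank m (Or.inl h0))
      rw [htop]
      exact le_top
    · exact nilpotencyOrder_eq_top fun n => S.comm_pow_ne_zero (by decide) h11 n
        fun m _ => hsum m (Or.inl h0)
  · rw [if_neg h0]
    have h3 := ringChar_three_le hchar h0
    constructor
    · simpa using hrank _ (Or.inr le_rfl)
    · obtain ⟨n, hn⟩ : ∃ n, ringChar k = n + 1 := ⟨ringChar k - 1, by omega⟩
      rw [hn]
      refine nilpotencyOrder_eq (S.comm_pow_eq_zero (by decide) h11 eq_zero_or_one n ?_)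
        (S.comm_pow_ne_zero (by decide) h11 n fun m hm => hsum m (Or.inr (by omega)))
      simp only [hp, one_pow, Finset.sum_const, Finset.card_range, nsmul_eq_mul, mul_one]
      rw [← hn, ringChar.Nat.cast_ringChar, mul_zero]

end

end DiagNichols

/-! ### The main theorem, case by case. -/

open scoped TensorProduct in
open DiagNichols NicholsAlgebra in
theorem mainTheorem2 {k : Type*} [Field k] [IsAlgClosed k] (hchar : ringChar k ≠ 2)
    (ξ : k) (hξ : IsPrimitiveRoot ξ 8)
    {V : Type*} [AddCommGroup V] [Module k V] (c : V ⊗[k] V →ₗ[k] V ⊗[k] V) :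
    -- the two-dimensional braided vector spaces
    (∀ x : Module.Basis (Fin 2) k V,
      (∀ q : kˣ, HasMatrix c x (b1 q) →
        Module.rank k (NicholsAlgebra c) = 4 ∧ IsCartanType (b1 q) ∧
        Ad c (x 0) (x 1) = 0 ∧ Ad c (x 1) (x 0) = 0 ∧
        nilpotencyOrder (ι c (x 0)) = 2 ∧ nilpotencyOrder (ι c (x 1)) = 2) ∧
      (HasMatrix c x b2 →
        Module.rank k (NicholsAlgebra c) = 8 ∧ IsCartanType (b2 : Matrix (Fin 2) (Fin 2) k) ∧
        Ad c (x 0) (x 1) = ι c (x 0) * ι c (x 1) + ι c (x 1) * ι c (x 0) ∧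
        nilpotencyOrder (ι c (x 0)) = 2 ∧ nilpotencyOrder (ι c (x 1)) = 2 ∧
        nilpotencyOrder (Ad c (x 0) (x 1)) = 2) ∧
      (∀ j : k, (j = ξ ^ 2 ∨ j = -ξ ^ 2) → HasMatrix c x (b3plus j) →
        Module.rank k (NicholsAlgebra c) = 16 ∧ ¬ IsCartanType (b3plus j) ∧
        Ad c (x 0) (x 1) = ι c (x 0) * ι c (x 1) - ι c (x 1) * ι c (x 0) ∧
        nilpotencyOrder (ι c (x 0)) = 2 ∧ nilpotencyOrder (ι c (x 1)) = 2 ∧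
        nilpotencyOrder (Ad c (x 0) (x 1)) = 4) ∧
      (∀ j : k, (j = ξ ^ 2 ∨ j = -ξ ^ 2) → HasMatrix c x (b3minus j) →
        Module.rank k (NicholsAlgebra c) = 16 ∧ ¬ IsCartanType (b3minus j) ∧
        Ad c (x 0) (x 1) = ι c (x 0) * ι c (x 1) + ι c (x 1) * ι c (x 0) ∧
        nilpotencyOrder (ι c (x 0)) = 2 ∧ nilpotencyOrder (ι c (x 1)) = 2 ∧
        nilpotencyOrder (Ad c (x 0) (x 1)) = 4) ∧
      (∀ j : k, (j = ξ ^ 2 ∨ j = -ξ ^ 2) → HasMatrix c x (b4 j) →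
        Module.rank k (NicholsAlgebra c) = 16 ∧ ¬ IsCartanType (b4 j) ∧
        Ad c (x 1) (x 0) = ι c (x 0) * ι c (x 1) + ι c (x 1) * ι c (x 0) ∧
        nilpotencyOrder (ι c (x 0)) = 4 ∧ nilpotencyOrder (ι c (x 1)) = 2 ∧
        nilpotencyOrder (Ad c (x 1) (x 0)) = 2) ∧
      (∀ j : k, (j = ξ ^ 2 ∨ j = -ξ ^ 2) → HasMatrix c x (b5 j) →
        8 * rootOrder (1 : kˣ) ≤ Cardinal.toENat (Module.rank k (NicholsAlgebra c)) ∧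
        24 ≤ 8 * rootOrder (1 : kˣ) ∧ ¬ IsCartanType (b5 j) ∧
        Ad c (x 1) (x 0) = ι c (x 0) * ι c (x 1) + ι c (x 1) * ι c (x 0) ∧
        nilpotencyOrder (ι c (x 0)) = 4 ∧ nilpotencyOrder (ι c (x 1)) = 2 ∧
        nilpotencyOrder (Ad c (x 1) (x 0)) = rootOrder (1 : kˣ)) ∧
      (∀ m : ℕ, (m = 1 ∨ m = 3 ∨ m = 5 ∨ m = 7) → HasMatrix c x (b6 ξ m) →
        Module.rank k (NicholsAlgebra c) = 32 ∧ ¬ IsCartanType (b6 ξ m) ∧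
        Ad c (x 0) (x 1) = ι c (x 0) * ι c (x 1) - ι c (x 1) * ι c (x 0) ∧
        nilpotencyOrder (ι c (x 0)) = 2 ∧ nilpotencyOrder (ι c (x 1)) = 2 ∧
        nilpotencyOrder (Ad c (x 0) (x 1)) = 8 ∧ nilpotencyOrder (Ad c (x 1) (x 0)) = 8)) ∧
    -- the three-dimensional braided vector spaces
    (∀ x : Module.Basis (Fin 3) k V, ∀ q₁ q₂ q₃ : kˣ, HasMatrix c x (b1three q₁ q₂ q₃) →
      IsQuantumLinear (b1three q₁ q₂ q₃) ∧ Module.rank k (NicholsAlgebra c) = 8 ∧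
      (∃ B : Module.Basis (Fin 2 × Fin 2 × Fin 2) k (NicholsAlgebra c), ∀ n, B n =
        ι c (x 0) ^ (n.1 : ℕ) * ι c (x 1) ^ (n.2.1 : ℕ) * ι c (x 2) ^ (n.2.2 : ℕ)) ∧
      Function.Surjective (FreeAlgebra.lift k fun i => ι c (x i)) ∧
      TwoSidedIdeal.ker (FreeAlgebra.lift k fun i => ι c (x i)) =
        TwoSidedIdeal.span (let X := FreeAlgebra.ι k (X := Fin 3)
          {X 0 ^ 2, X 1 ^ 2, X 2 ^ 2,
           X 1 * X 0 - (q₁ : k) • (X 0 * X 1),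
           X 2 * X 0 - (q₃ : k) • (X 0 * X 2),
           X 2 * X 1 - (q₂ : k) • (X 1 * X 2)})) := by
  have h2 := isPrimitiveRoot_neg_one hchar
  have h4 : ∀ j : k, (j = ξ ^ 2 ∨ j = -ξ ^ 2) → IsPrimitiveRoot j 4 := by
    have h : IsPrimitiveRoot (ξ ^ 2) 4 := hξ.pow (by norm_num) (by norm_num)
    have h' : -ξ ^ 2 = (ξ ^ 2) ^ 3 := by
      have : (ξ ^ 2) ^ 2 = -1 :=
        IsPrimitiveRoot.eq_neg_one_of_two_right (h.pow (b := 2) (by norm_num) (by norm_num))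
      rw [pow_succ (ξ ^ 2) 2, this, neg_one_mul]
    rintro j (rfl | rfl)
    · exact h
    · rw [h']; exact h.pow_of_coprime 3 (by norm_num)
  have hsq : ∀ j : k, IsPrimitiveRoot j 4 → j ^ 2 = -1 := fun j hj =>
    IsPrimitiveRoot.eq_neg_one_of_two_right (hj.pow (b := 2) (by norm_num) (by norm_num))
  have hsq' : ∀ j : k, IsPrimitiveRoot j 4 → (-j) ^ 2 ≠ 1 := fun j hj => by
    rw [neg_sq, hsq j hj]; exact h2.ne_one one_lt_two
  have hneg : ∀ j : k, IsPrimitiveRoot j 4 → IsPrimitiveRoot (-j) 4 := fun j hj => by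
    have : -j = j ^ 3 := by rw [pow_succ, hsq j hj, neg_one_mul]
    rw [this]; exact hj.pow_of_coprime 3 (by norm_num)
  refine ⟨fun x => ⟨fun q hc => nichols_b1 hchar hc, fun hc => ?_, fun j hj hc => ?_,
    fun j hj hc => ?_, fun j hj hc => ?_, fun j hj hc => ?_, fun m hm hc => ?_⟩,
    fun x q₁ q₂ q₃ hc => quantumLinearSpace hc⟩
  · obtain ⟨hr, h0, h1, h01, -⟩ := nichols_of_diag_neg_one hchar hc rfl rfl one_lt_two
      (by simpa [b2] using h2)
    -- The exponents are applied to -1, so only their parity matters and 1 serves in place of the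
    -- usual -1.
    refine ⟨by rw [hr]; norm_num, ⟨!![2, 1; 1, 2], fun i j => ?_⟩, ?_, h0, h1, by exact_mod_cast h01⟩
    · fin_cases i <;> fin_cases j <;> simp [b2]
    · rw [Ad_eq hc]; simp [b2]
  · have hj4 := h4 j hj
    obtain ⟨hr, h0, h1, h01, -⟩ := nichols_of_diag_neg_one (N := 4) hchar hc rfl rfl (by norm_num)
      (by simpa [b3plus] using hj4)
    refine ⟨by rw [hr]; norm_num, not_isCartanType (i := 0) (j := 1) rfl ?_, ?_, h0, h1,
      by exact_mod_cast h01⟩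
    · simpa [b3plus] using hsq' j hj4
    · rw [Ad_eq hc]; simp [b3plus]
  · have hj4 := h4 j hj
    obtain ⟨hr, h0, h1, h01, -⟩ := nichols_of_diag_neg_one (N := 4) hchar hc rfl rfl (by norm_num)
      (by simpa [b3minus] using hneg j hj4)
    refine ⟨by rw [hr]; norm_num, not_isCartanType (i := 0) (j := 1) rfl ?_, ?_, h0, h1,
      by exact_mod_cast h01⟩
    · simpa [b3minus] using hsq' j hj4
    · rw [Ad_eq hc]; simp [b3minus]
  · have hj4 := h4 j hj
    have hjj : j * j = -1 := by rw [← pow_two, hsq j hj4]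
    -- Here b_ss = j and b_st b_ts = -j, so b_ss b_st b_ts = 1 and p = -1, giving M = 4 and N = 2.
    obtain ⟨hr, h01⟩ := rank_and_nilpotencyOrder_Ad hc (s := 0) (t := 1) (M := 4) (N := 2)
      (by decide) eq_zero_or_one rfl (by simpa [b4] using (hneg j hj4).ne_one (by norm_num))
      (by simp [b4, hjj]) (by norm_num) one_lt_two hj4
      (by simpa [SkewDerivationSystem.commParam, b4, hjj] using h2)
    refine ⟨by rw [hr]; norm_num, not_isCartanType (i := 1) (j := 0) rfl ?_, ?_,
      nilpotencyOrder_gen hc 0 (N := 4) (by norm_num) hj4,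
      nilpotencyOrder_gen hc 1 one_lt_two h2, by exact_mod_cast h01⟩
    · simpa [b4] using hsq' j hj4
    · rw [Ad_eq hc]; simp [b4, add_comm]
  · have hj4 := h4 j hj
    obtain ⟨hr, h01⟩ := nichols_b5 hchar hj4 hc
    refine ⟨hr, ?_, not_isCartanType (i := 1) (j := 0) rfl ?_, ?_,
      nilpotencyOrder_gen hc 0 (N := 4) (by norm_num) hj4,
      nilpotencyOrder_gen hc 1 one_lt_two h2, h01⟩
    · rw [rootOrder_one]
      split_ifs with h0
      · simp
      · exact_mod_cast Nat.mul_le_mul_left 8 (ringChar_three_le hchar h0)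
    · simpa [b5] using hsq' j hj4
    · rw [Ad_eq hc]; simp [b5, add_comm]
  · have hm8 : IsPrimitiveRoot (ξ ^ m) 8 :=
      hξ.pow_of_coprime m (by rcases hm with rfl | rfl | rfl | rfl <;> norm_num)
    obtain ⟨hr, h0, h1, h01, h10⟩ := nichols_of_diag_neg_one (N := 8) hchar hc rfl rfl
      (by norm_num) (by simpa [b6] using hm8)
    refine ⟨by rw [hr]; norm_num, not_isCartanType (i := 0) (j := 1) rfl ?_, ?_, h0, h1,
      by exact_mod_cast h01, by exact_mod_cast h10⟩
    · simpa [b6] using hm8.pow_ne_one_of_pos_of_lt two_ne_zero (by norm_num)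
    · rw [Ad_eq hc]; simp [b6]
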